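/- Let $k$ be an algebraically closed field of characteristic zero, $G$ a finite group, and $\alpha:G\times G\times G\to k^*$ a normalised 3-cocycle: $\alpha(g,h,l)\alpha(f,gh,l)\alpha(f,g,h)=\alpha(fg,h,l)\alpha(f,g,hl)$, and $\alpha(f,g,h)=1$ whenever one of $f,g,h$ is the identity $e$. Put $$\alpha(f,g|h)=\alpha(f,g,h)^{-1}\alpha(f,ghg^{-1},g)\,\alpha(fgh(fg)^{-1},f,g)^{-1},$$ $$\alpha(f|g,h)=\alpha(f,g,h)\,\alpha(fgf^{-1},f,h)^{-1}\alpha(fgf^{-1},fhf^{-1},f).$$ Let $\mathcal Z(G,\alpha)$ be the braided monoidal category of finite-dimensional $G$-graded vector spaces $V=\bigoplus_{g\in G}V_g$ with automorphisms $v\mapsto f.v$ ($f\in G$) such that $f.V_g=V_{fgf^{-1}}$ and $(fg).v=\alpha(f,g|h)\,f.(g.v)$ for $v\in V_h$; morphisms are the linear maps that preserve grading and action. The action on the graded tensor product is $f.(x\otimes y)=\alpha(f|g,h)\,f.x\otimes f.y$, the associator is $x\otimes(y\otimes z)\mapsto\alpha(f,g,h)(x\otimes y)\otimes z$ for homogeneous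 elements of the degrees $f,g,h$, the unit is $k$ in degree $e$ with trivial action, and the braiding is $x\otimes y\mapsto f.y\otimes x$ for $x$ of degree $f$. So an algebra in $\mathcal Z(G,\alpha)$ is an object $A$ with a graded bilinear multiplication such that $f.(ab)=\alpha(f|g,h)(f.a)(f.b)$ for $a\in A_g$, $b\in A_h$ and $a(bc)=\alpha(f,g,h)(ab)c$ for $a\in A_f,b\in A_g,c\in A_h$, and a $G$-invariant two-sided unit in $A_e$. It is commutative if $ab=(f.b)a$ for $a\in A_f$, $b\in A$; it is separable if the pairing $(a,b)\mapsto\tau(ab)$ is nondegenerate, where $\tau(a)$ is the trace of the left multiplication by $a$; it is indecomposable if it is nonzero and not a direct sum of two nonzero algebras in $\mathcal Z(G,\alpha)$. An algebra is called étale if it is indecomposable, commutative and separable. For a subgroup $H\subseteq G$ and an algebra $B$ in $\mathcal Z(H,\alpha|_H)$, regarded as a $G$-graded space supported in $H$, let $E(B)=\bigoplus_{f\in G}E(B)_f$, where $E(B)_f$ is the space of the maps $a:G\to B$ such that, for all $x\in G$ and $h\in H$, $$a(x)\in B_{x^{-1}fx},\qquad a(xh)=\alpha(h^{-1},x^{-1}|f)\,h^{-1}.a(x).$$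 It is an algebra in $\mathcal Z(G,\alpha)$, with $(g.a)(x)=\alpha(x^{-1},g|f)^{-1}a(g^{-1}x)$ and $(ab)(x)=\alpha(x^{-1}|f,f')\,a(x)b(x)$ for $a\in E(B)_f$, $b\in E(B)_{f'}$, the unit being the constant map with value $1_B$. **Theorem.** Every étale algebra in $\mathcal Z(G,\alpha)$ is isomorphic, as an algebra in $\mathcal Z(G,\alpha)$, to $$A(H,F,\gamma,\varepsilon)=E\big(k[F,\gamma,\varepsilon]\big)$$ for some subgroup $H\subseteq G$, normal subgroup $F\trianglelefteq H$, normalised cochain $\gamma:F\times F\to k^*$ (that is, $\gamma(e,f)=\gamma(f,e)=1$) with $d\gamma=\alpha|_F$, i.e. $\gamma(g,h)\gamma(fg,h)^{-1}\gamma(f,gh)\gamma(f,g)^{-1}=\alpha(f,g,h)$ for $f,g,h\in F$, and map $\varepsilon:H\times F\to k^*$, $(h,f)\mapsto\varepsilon_h(f)$, satisfying $$\varepsilon_{gh}(f)=\varepsilon_g(hfh^{-1})\,\varepsilon_h(f)\,\alpha(g,h|f),\qquad g,h\in H,\ f\in F,$$ $$\gamma(f,g)\,\varepsilon_h(fg)=\alpha(h|f,g)\,\varepsilon_h(f)\,\varepsilon_h(g)\,\gamma(hfh^{-1},hgh^{-1}),\qquad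 h\in H,\ f,g\in F,$$ $$\gamma(f,g)=\varepsilon_f(g)\,\gamma(fgf^{-1},f),\qquad f,g\in F.$$ Here $k[F,\gamma,\varepsilon]$ is the algebra in $\mathcal Z(H,\alpha|_H)$ with basis $(e_f)_{f\in F}$, $e_f$ of degree $f$, multiplication $e_fe_g=\gamma(f,g)e_{fg}$ and $H$-action $h.e_f=\varepsilon_h(f)e_{hfh^{-1}}$. -/

import Mathlib

universe u v w w'

namespace TwistedCentre

/-- A normalised 3-cocycle of `G` with coefficients in `kˣ` (trivial action). -/
structure Cocycle3 (G : Type v) [Group G] (k : Type u) [Field k] where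
  toFun : G → G → G → kˣ
  cocycle : ∀ f g h l, toFun g h l * toFun f (g * h) l * toFun f g h =
    toFun (f * g) h l * toFun f g (h * l)
  one_left : ∀ g h, toFun 1 g h = 1
  one_mid : ∀ f h, toFun f 1 h = 1
  one_right : ∀ f g, toFun f g 1 = 1

namespace Cocycle3

variable {G : Type v} [Group G] {k : Type u} [Field k]

instance : CoeFun (Cocycle3 G k) (fun _ => G → G → G → kˣ) := ⟨Cocycle3.toFun⟩

/-- `α(f, g | h) = α(f,g,h)⁻¹ α(f, ghg⁻¹, g) α(fgh(fg)⁻¹, f, g)⁻¹`. -/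
def proj (α : Cocycle3 G k) (f g h : G) : kˣ :=
  (α f g h)⁻¹ * α f (g * h * g⁻¹) g * (α (f * g * h * (f * g)⁻¹) f g)⁻¹

/-- `α(f | g, h) = α(f,g,h) α(fgf⁻¹, f, h)⁻¹ α(fgf⁻¹, fhf⁻¹, f)`. -/
def tens (α : Cocycle3 G k) (f g h : G) : kˣ :=
  α f g h * (α (f * g * f⁻¹) f h)⁻¹ * α (f * g * f⁻¹) (f * h * f⁻¹) f

/-- The restriction of a cocycle to a subgroup. -/
def restrict (α : Cocycle3 G k) (H : Subgroup G) : Cocycle3 H k where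
  toFun f g h := α f g h
  cocycle f g h l := α.cocycle f g h l
  one_left g h := α.one_left g h
  one_mid f h := α.one_mid f h
  one_right f g := α.one_right f g

lemma proj_restrict (α : Cocycle3 G k) (H : Subgroup G) (f g h : H) :
    (α.restrict H).proj f g h = α.proj f g h := rfl

lemma tens_restrict (α : Cocycle3 G k) (H : Subgroup G) (f g h : H) :
    (α.restrict H).tens f g h = α.tens f g h := rfl

lemma proj_proj (α : Cocycle3 G k) (f g h u : G) :
    α.proj f (g * h) u * α.proj g h u = α.proj (f * g) h u * α.proj f g (h * u * h⁻¹) := by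
  have h1 := congrArg Additive.ofMul (α.cocycle f g h u)
  have h2 := congrArg Additive.ofMul (α.cocycle f g (h * u * h⁻¹) h)
  have h3 := congrArg Additive.ofMul (α.cocycle f (g * h * u * (g * h)⁻¹) g h)
  have h4 := congrArg Additive.ofMul (α.cocycle (f * g * h * u * (f * g * h)⁻¹) f g h)
  apply Additive.ofMul.injective
  simp only [proj, ofMul_mul, ofMul_inv, mul_assoc, mul_inv_rev, inv_mul_cancel_left,
    mul_inv_cancel_left, inv_mul_cancel, mul_inv_cancel, mul_one] at *
  linear_combination (norm := abel) - h1 + h2 - h3 + h4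

lemma tens_proj (α : Cocycle3 G k) (f g u v : G) :
    α.tens (f * g) u v * α.proj f g u * α.proj f g v =
      α.proj f g (u * v) * α.tens g u v * α.tens f (g * u * g⁻¹) (g * v * g⁻¹) := by
  have h1 := congrArg Additive.ofMul (α.cocycle f g u v)
  have h2 := congrArg Additive.ofMul (α.cocycle f (g * u * g⁻¹) g v)
  have h3 := congrArg Additive.ofMul (α.cocycle (f * g * u * (f * g)⁻¹) f g v)
  have h4 := congrArg Additive.ofMul (α.cocycle f (g * u * g⁻¹) (g * v * g⁻¹) g)
  have h5 := congrArg Additive.ofMul (α.cocycle (f * g * u * (f * g)⁻¹) f (g * v * g⁻¹) g)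
  have h6 := congrArg Additive.ofMul
    (α.cocycle (f * g * u * (f * g)⁻¹) (f * g * v * (f * g)⁻¹) f g)
  apply Additive.ofMul.injective
  simp only [proj, tens, ofMul_mul, ofMul_inv, mul_assoc, mul_inv_rev, inv_mul_cancel_left,
    mul_inv_cancel_left, inv_mul_cancel, mul_inv_cancel, mul_one] at *
  linear_combination (norm := abel) - h1 + h2 - h3 - h4 + h5 - h6

lemma tens_tens (α : Cocycle3 G k) (f g h u : G) :
    α g h u * α.tens f (g * h) u * α.tens f g h =
      α.tens f g (h * u) * α.tens f h u * α (f * g * f⁻¹) (f * h * f⁻¹) (f * u * f⁻¹) := by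
  have h1 := congrArg Additive.ofMul (α.cocycle f g h u)
  have h2 := congrArg Additive.ofMul (α.cocycle (f * g * f⁻¹) f h u)
  have h3 := congrArg Additive.ofMul (α.cocycle (f * g * f⁻¹) (f * h * f⁻¹) f u)
  have h4 := congrArg Additive.ofMul
    (α.cocycle (f * g * f⁻¹) (f * h * f⁻¹) (f * u * f⁻¹) f)
  apply Additive.ofMul.injective
  simp only [tens, ofMul_mul, ofMul_inv, mul_assoc, mul_inv_rev, inv_mul_cancel_left,
    mul_inv_cancel_left, inv_mul_cancel, mul_inv_cancel, mul_one] at *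
  linear_combination (norm := abel) h1 - h2 + h3 - h4

end Cocycle3

/-- An object of `Z(G, α)`: a finite-dimensional `G`-graded vector space with an `α`-projective
`G`-action. -/
structure ZObj {G : Type v} [Group G] {k : Type u} [Field k] (α : Cocycle3 G k) where
  carrier : Type w
  [addCommGroup : AddCommGroup carrier]
  [module : Module k carrier]
  [finiteDimensional : FiniteDimensional k carrier]
  /-- the homogeneous components -/
  grade : G → Submodule k carrier
  indep : iSupIndep grade
  iSup_grade : ⨆ g, grade g = ⊤
  /-- the action of the elements of `G` -/
  act : G → carrier →ₗ[k] carrier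
  act_bijective : ∀ f, Function.Bijective (act f)
  map_act : ∀ f g, (grade g).map (act f) = grade (f * g * f⁻¹)
  act_act : ∀ f g h, ∀ x ∈ grade h, act (f * g) x = (α.proj f g h : k) • act f (act g x)

attribute [instance] ZObj.addCommGroup ZObj.module ZObj.finiteDimensional

/-- An algebra in `Z(G, α)`: an object `A` with morphisms `A ⊗ A → A` and `I → A` of `Z(G, α)`,
associative with respect to the associator of `Z(G, α)`, and unital. A morphism `A ⊗ A → A` is
written as a bilinear map that respects the degrees and the action
`f.(x ⊗ y) = α(f | g, h) f.x ⊗ f.y` (`x` of degree `g`, `y` of degree `h`) of `G` on `A ⊗ A`; the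
associator is `x ⊗ (y ⊗ z) ↦ α(f, g, h) (x ⊗ y) ⊗ z` on elements of degrees `f`, `g`, `h`. -/
structure ZAlg {G : Type v} [Group G] {k : Type u} [Field k] (α : Cocycle3 G k) extends
    ZObj.{u, v, w} α where
  mul : carrier →ₗ[k] carrier →ₗ[k] carrier
  one : carrier
  mul_mem : ∀ f g, ∀ x ∈ grade f, ∀ y ∈ grade g, mul x y ∈ grade (f * g)
  act_mul : ∀ f g h, ∀ x ∈ grade g, ∀ y ∈ grade h,
    act f (mul x y) = (α.tens f g h : k) • mul (act f x) (act f y)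
  one_mem : one ∈ grade 1
  act_one : ∀ f, act f one = one
  mul_assoc : ∀ f g h, ∀ x ∈ grade f, ∀ y ∈ grade g, ∀ z ∈ grade h,
    mul x (mul y z) = (α f g h : k) • mul (mul x y) z
  one_mul : ∀ x, mul one x = x
  mul_one : ∀ x, mul x one = x

namespace ZAlg

variable {G : Type v} [Group G] {k : Type u} [Field k] {α : Cocycle3 G k}

/-- Isomorphisms of algebras in `Z(G, α)`. -/
structure Iso (A : ZAlg.{u, v, w} α) (B : ZAlg.{u, v, w'} α) where
  toEquiv : A.carrier ≃ₗ[k] B.carrier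
  map_grade : ∀ g, ∀ x ∈ A.grade g, toEquiv x ∈ B.grade g
  map_act : ∀ g x, toEquiv (A.act g x) = B.act g (toEquiv x)
  map_mul : ∀ x y, toEquiv (A.mul x y) = B.mul (toEquiv x) (toEquiv y)
  map_one : toEquiv A.one = B.one

variable (A : ZAlg.{u, v, w} α)

/-- Commutativity with respect to the braiding `x ⊗ y ↦ f.y ⊗ x`, `x` of degree `f`. -/
def IsCommutative : Prop :=
  ∀ f, ∀ x ∈ A.grade f, ∀ y, A.mul x y = A.mul (A.act f y) x

/-- The canonical trace function `A → I`, i.e. the trace of the left multiplication. (For `x` of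
degree `f ≠ 1` the left multiplication by `x` moves the degrees, and its trace is zero; for `x` of
degree `1` the associator does not contribute.) -/
noncomputable def trace : A.carrier →ₗ[k] k :=
  LinearMap.trace k A.carrier ∘ₗ A.mul

/-- The pairing `A ⊗ A → I`, `x ⊗ y ↦ trace (x y)`. -/
noncomputable def traceForm : A.carrier →ₗ[k] A.carrier →ₗ[k] k :=
  A.mul.compr₂ A.trace

/-- `A` is separable if its trace pairing is nondegenerate. -/
def IsSeparable : Prop := A.traceForm.Nondegenerate

/-- Two-sided ideals of `A` in `Z(G, α)`: graded, stable under the action, and closed under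
multiplication by elements of `A` from both sides. -/
structure IsIdeal (I : Submodule k A.carrier) : Prop where
  graded : I ≤ ⨆ g, I ⊓ A.grade g
  act_mem : ∀ g, ∀ x ∈ I, A.act g x ∈ I
  mul_mem_left : ∀ y, ∀ x ∈ I, A.mul y x ∈ I
  mul_mem_right : ∀ y, ∀ x ∈ I, A.mul x y ∈ I

/-- `A` is nonzero, and is not the direct sum of two nonzero algebras in `Z(G, α)`. (The summands
of a direct sum of algebras are complementary two-sided ideals, and conversely.) -/
def IsIndecomposable : Prop :=
  Nontrivial A.carrier ∧
    ∀ I J : Submodule k A.carrier, A.IsIdeal I → A.IsIdeal J → IsCompl I J → I = ⊥ ∨ J = ⊥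

/-- Etale algebras: indecomposable, commutative and separable. -/
structure IsEtale : Prop where
  indecomposable : A.IsIndecomposable
  commutative : A.IsCommutative
  separable : A.IsSeparable

end ZAlg

namespace ZObj

variable {G : Type v} [Group G] {k : Type u} [Field k] {α : Cocycle3 G k}

open Classical in
lemma bijective_coe (X : ZObj.{u, v, w} α) :
    Function.Bijective (DirectSum.coeLinearMap X.grade) :=
  (DirectSum.isInternal_submodule_iff_iSupIndep_and_iSup_eq_top _).2 ⟨X.indep, X.iSup_grade⟩

open Classical in
/-- The projection to the component of degree `g`. -/
noncomputable def comp (X : ZObj.{u, v, w} α) (g : G) : X.carrier →ₗ[k] X.carrier :=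
  (X.grade g).subtype ∘ₗ DirectSum.component k G (fun i => X.grade i) g ∘ₗ
    (LinearEquiv.ofBijective (DirectSum.coeLinearMap X.grade) X.bijective_coe).symm.toLinearMap

open Classical in
lemma comp_of_mem (X : ZObj.{u, v, w} α) {g h : G} {x : X.carrier} (hx : x ∈ X.grade h) :
    X.comp g x = if g = h then x else 0 := by
  have : (LinearEquiv.ofBijective (DirectSum.coeLinearMap X.grade) X.bijective_coe).symm x =
      DirectSum.lof k G (fun i => X.grade i) h ⟨x, hx⟩ := by
    rw [LinearEquiv.symm_apply_eq]
    simp [LinearEquiv.ofBijective_apply]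
  simp only [comp, LinearMap.comp_apply, LinearEquiv.coe_coe, this]
  split_ifs with hgh
  · subst hgh
    simp
  · rw [DirectSum.component.of, dif_neg (Ne.symm hgh)]
    simp

lemma act_mem (X : ZObj.{u, v, w} α) (f : G) {g : G} {x : X.carrier} (hx : x ∈ X.grade g) :
    X.act f x ∈ X.grade (f * g * f⁻¹) :=
  X.map_act f g ▸ Submodule.mem_map_of_mem hx

lemma act_one_apply (X : ZObj.{u, v, w} α) (x : X.carrier) : X.act 1 x = x := by
  have hx : x ∈ ⨆ g, X.grade g := X.iSup_grade ▸ Submodule.mem_top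
  induction hx using Submodule.iSup_induction' with
  | mem g x hx =>
    have h := X.act_act 1 1 g x hx
    simp only [Cocycle3.proj, mul_one, one_mul, α.one_left, α.one_mid, inv_one, Units.val_one,
      one_smul, α.one_right] at h
    exact ((X.act_bijective 1).1 h).symm
  | zero => simp
  | add x y _ _ hx hy => rw [map_add, hx, hy]

end ZObj

section Projective

variable {G : Type v} [Group G] {k : Type u} [Field k] (α : Cocycle3 G k)
  {V : Type w} [AddCommGroup V] [Module k V]
  {grade : G → Submodule k V} {act : G → V →ₗ[k] V}

lemma map_eq_of_projective (one : ∀ x, act 1 x = x)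
    (mem : ∀ f g x, x ∈ grade g → act f x ∈ grade (f * g * f⁻¹))
    (mul : ∀ f g h, ∀ x ∈ grade h, act (f * g) x = (α.proj f g h : k) • act f (act g x))
    (f g : G) : (grade g).map (act f) = grade (f * g * f⁻¹) := by
  refine le_antisymm ?_ ?_
  · rintro _ ⟨x, hx, rfl⟩
    exact mem f g x hx
  · intro y hy
    have h1 := mem f⁻¹ _ y hy
    have h2 := mul f f⁻¹ _ y hy
    rw [mul_inv_cancel, one, ← map_smul] at h2
    rw [h2]
    refine Submodule.mem_map_of_mem (Submodule.smul_mem _ _ ?_)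
    convert h1 using 2
    group

lemma bijective_of_projective [FiniteDimensional k V] (top : ⨆ g, grade g = ⊤)
    (one : ∀ x, act 1 x = x)
    (mem : ∀ f g x, x ∈ grade g → act f x ∈ grade (f * g * f⁻¹))
    (mul : ∀ f g h, ∀ x ∈ grade h, act (f * g) x = (α.proj f g h : k) • act f (act g x))
    (f : G) : Function.Bijective (act f) := by
  have hs : Function.Surjective (act f) := by
    rw [← LinearMap.range_eq_top, eq_top_iff, ← top]
    refine iSup_le fun g => ?_
    have h := map_eq_of_projective α one mem mul f (f⁻¹ * g * f)
    have e : f * (f⁻¹ * g * f) * f⁻¹ = g := by group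
    rw [e] at h
    rw [← h]
    exact LinearMap.map_le_range
  exact ⟨LinearMap.injective_iff_surjective.2 hs, hs⟩

end Projective

section TwistedGroupAlgebra

variable {H : Type v} [Group H] {k : Type u} [Field k]

/-- The conditions on the data `F ⊴ H`, `γ ∈ C²(F, kˣ)` (a normalised cochain) and
`ε : H × F → kˣ` that define an etale algebra in `Z(H, β)` with basis `(e_f)`, `f ∈ F`. Here
`MulAut.conjNormal h f` is `h f h⁻¹` as an element of `F`. -/
structure IsCompatible (β : Cocycle3 H k) (F : Subgroup H) [F.Normal] (γ : F → F → kˣ)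
    (ε : H → F → kˣ) : Prop where
  one_left : ∀ f, γ 1 f = 1
  one_right : ∀ f, γ f 1 = 1
  /-- `d γ = β|_F` -/
  coboundary : ∀ f g h : F,
    γ g h * (γ (f * g) h)⁻¹ * γ f (g * h) * (γ f g)⁻¹ = β f g h
  eps1 : ∀ (g h : H) (f : F),
    ε (g * h) f = ε g (MulAut.conjNormal h f) * ε h f * β.proj g h f
  eps2 : ∀ (h : H) (f g : F),
    γ f g * ε h (f * g) = β.tens h f g * ε h f * ε h g *
      γ (MulAut.conjNormal h f) (MulAut.conjNormal h g)
  eps3 : ∀ f g : F,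
    γ f g = ε f g * γ (MulAut.conjNormal (f : H) g) f

variable {β : Cocycle3 H k} {F : Subgroup H} [F.Normal] {γ : F → F → kˣ} {ε : H → F → kˣ}

lemma IsCompatible.eps_one (h : IsCompatible β F γ ε) (x : H) : ε x 1 = 1 := by
  have := h.eps2 x 1 1
  simpa [h.one_left, Cocycle3.tens, β.one_mid, β.one_right, β.one_left] using this

variable (k F) in
/-- The component of degree `h` of the space with basis `(e_f)`, `f ∈ F`. -/
def groupAlgGrade (h : H) : Submodule k (F →₀ k) :=
  Finsupp.supported k k {f : F | (f : H) = h}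

/-- The `H`-action `h(e_f) = ε_h(f) e_{hfh⁻¹}`. -/
noncomputable def groupAlgAct (ε : H → F → kˣ) (h : H) : (F →₀ k) →ₗ[k] (F →₀ k) :=
  Finsupp.linearCombination k fun f => Finsupp.single (MulAut.conjNormal h f) (ε h f : k)

/-- The multiplication `e_f e_g = γ(f, g) e_{fg}`. -/
noncomputable def groupAlgMul (γ : F → F → kˣ) : (F →₀ k) →ₗ[k] (F →₀ k) →ₗ[k] (F →₀ k) :=
  Finsupp.linearCombination k fun f =>
    Finsupp.linearCombination k fun g => Finsupp.single (f * g) (γ f g : k)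

lemma groupAlgAct_single (h : H) (f : F) (c : k) :
    groupAlgAct ε h (Finsupp.single f c) =
      Finsupp.single (MulAut.conjNormal h f) (c * (ε h f : k)) := by
  simp [groupAlgAct]

lemma groupAlgMul_single (f g : F) (c d : k) :
    groupAlgMul γ (Finsupp.single f c) (Finsupp.single g d) =
      Finsupp.single (f * g) (c * d * (γ f g : k)) := by
  simp only [groupAlgMul, Finsupp.linearCombination_single, LinearMap.smul_apply,
    Finsupp.smul_single, smul_eq_mul, _root_.mul_assoc]

lemma mem_groupAlgGrade {h : H} {x : F →₀ k} (hx : x ∈ groupAlgGrade k F h) :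
    x = 0 ∨ ∃ (f : F) (c : k), (f : H) = h ∧ x = Finsupp.single f c := by
  by_cases hh : h ∈ F
  · right
    refine ⟨⟨h, hh⟩, x ⟨h, hh⟩, rfl, ?_⟩
    ext g
    by_cases hg : (⟨h, hh⟩ : F) = g
    · subst hg; simp
    · rw [Finsupp.single_eq_of_ne (Ne.symm hg)]
      by_contra hne
      have : g ∈ {f : F | (f : H) = h} := hx (by simpa using hne)
      exact hg (Subtype.ext (Eq.symm this))
  · left
    ext g
    by_contra hne
    have : g ∈ {f : F | (f : H) = h} := hx (by simpa using hne)
    exact hh (this ▸ g.2)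

lemma single_mem_groupAlgGrade (f : F) (c : k) {h : H} (hf : (f : H) = h) :
    Finsupp.single f c ∈ groupAlgGrade k F h :=
  Finsupp.single_mem_supported k c hf

lemma iSupIndep_groupAlgGrade : iSupIndep (groupAlgGrade k F) := by
  intro h
  rw [Submodule.disjoint_def]
  intro x hx hx'
  have h1 : (⨆ j, ⨆ (_ : j ≠ h), groupAlgGrade k F j) ≤
      Finsupp.supported k k {f : F | (f : H) ≠ h} := by
    refine iSup₂_le fun j hj => Finsupp.supported_mono ?_
    rintro f rfl
    exact hj
  have h2 := h1 hx'
  ext f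
  by_contra hne
  have hf : f ∈ x.support := by simpa using hne
  exact h2 hf (hx hf)

lemma iSup_groupAlgGrade : ⨆ h, groupAlgGrade k F h = ⊤ := by
  rw [eq_top_iff]
  rintro x -
  induction x using Finsupp.induction_linear with
  | zero => exact zero_mem _
  | add x y hx hy => exact add_mem hx hy
  | single f c => exact Submodule.mem_iSup_of_mem (f : H) (single_mem_groupAlgGrade f c rfl)

lemma groupAlgAct_mem (f : H) {g : H} {x : F →₀ k} (hx : x ∈ groupAlgGrade k F g) :
    groupAlgAct ε f x ∈ groupAlgGrade k F (f * g * f⁻¹) := by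
  obtain rfl | ⟨a, c, rfl, rfl⟩ := mem_groupAlgGrade hx
  · simp
  · rw [groupAlgAct_single]
    exact single_mem_groupAlgGrade _ _ (by simp)

lemma IsCompatible.act_act (h : IsCompatible β F γ ε) {f g l : H} {x : F →₀ k}
    (hx : x ∈ groupAlgGrade k F l) :
    groupAlgAct ε (f * g) x = (β.proj f g l : k) • groupAlgAct ε f (groupAlgAct ε g x) := by
  obtain rfl | ⟨a, c, rfl, rfl⟩ := mem_groupAlgGrade hx
  · simp
  · simp only [groupAlgAct_single, Finsupp.smul_single, smul_eq_mul, h.eps1, map_mul,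
      MulAut.mul_apply, Units.val_mul]
    congr 1
    ring

lemma IsCompatible.act_one_apply (h : IsCompatible β F γ ε) (x : F →₀ k) :
    groupAlgAct ε 1 x = x := by
  have h1 : ∀ f, ε 1 f = 1 := fun f => by
    simpa [Cocycle3.proj, β.one_left, β.one_mid, β.one_right] using h.eps1 1 1 f
  induction x using Finsupp.induction_linear with
  | zero => simp
  | add x y hx hy => rw [map_add, hx, hy]
  | single f c => simp [groupAlgAct_single, h1]

/-- The algebra `k[F, γ, ε]` in `Z(H, β)`. -/
noncomputable def twistedGroupAlg [Finite H] (h : IsCompatible β F γ ε) : ZAlg.{u, v} β where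
  carrier := F →₀ k
  grade := groupAlgGrade k F
  indep := iSupIndep_groupAlgGrade
  iSup_grade := iSup_groupAlgGrade
  act := groupAlgAct ε
  act_bijective := bijective_of_projective β iSup_groupAlgGrade h.act_one_apply
    (fun f _ _ hx => groupAlgAct_mem f hx) (fun _ _ _ _ hx => h.act_act hx)
  map_act := map_eq_of_projective β h.act_one_apply
    (fun f _ _ hx => groupAlgAct_mem f hx) (fun _ _ _ _ hx => h.act_act hx)
  act_act _ _ _ _ hx := h.act_act hx
  mul := groupAlgMul γ
  one := Finsupp.single 1 1
  mul_mem f g x hx y hy := by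
    obtain rfl | ⟨a, c, rfl, rfl⟩ := mem_groupAlgGrade hx
    · simp
    obtain rfl | ⟨b, d, rfl, rfl⟩ := mem_groupAlgGrade hy
    · simp
    rw [groupAlgMul_single]
    exact single_mem_groupAlgGrade _ _ rfl
  act_mul f g l x hx y hy := by
    obtain rfl | ⟨a, c, rfl, rfl⟩ := mem_groupAlgGrade hx
    · simp
    obtain rfl | ⟨b, d, rfl, rfl⟩ := mem_groupAlgGrade hy
    · simp
    have := congrArg (Units.val) (h.eps2 f a b)
    simp only [Units.val_mul] at this
    simp only [groupAlgAct_single, groupAlgMul_single, Finsupp.smul_single, smul_eq_mul, map_mul]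
    congr 1
    linear_combination (c * d) * this
  one_mem := single_mem_groupAlgGrade _ _ rfl
  act_one f := by simp [groupAlgAct_single, h.eps_one]
  mul_assoc f g l x hx y hy z hz := by
    obtain rfl | ⟨a, c, rfl, rfl⟩ := mem_groupAlgGrade hx
    · simp
    obtain rfl | ⟨b, d, rfl, rfl⟩ := mem_groupAlgGrade hy
    · simp
    obtain rfl | ⟨e, r, rfl, rfl⟩ := mem_groupAlgGrade hz
    · simp
    have h1 : γ b e * γ a (b * e) = β a b e * γ a b * γ (a * b) e := by
      rw [← h.coboundary]
      apply Additive.ofMul.injective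
      simp only [ofMul_mul, ofMul_inv]
      abel
    have := congrArg (Units.val) h1
    simp only [Units.val_mul] at this
    simp only [groupAlgMul_single, Finsupp.smul_single, smul_eq_mul, mul_assoc]
    congr 1
    linear_combination (c * d * r) * this
  one_mul x := by
    induction x using Finsupp.induction_linear with
    | zero => simp
    | add x y hx hy => rw [map_add, hx, hy]
    | single f c => simp [groupAlgMul_single, h.one_left]
  mul_one x := by
    induction x using Finsupp.induction_linear with
    | zero => simp
    | add x y hx hy => rw [map_add, LinearMap.add_apply, hx, hy]
    | single f c => simp [groupAlgMul_single, h.one_right]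

end TwistedGroupAlgebra

section Transfer

variable {G : Type v} [Group G] {k : Type u} [Field k] {α : Cocycle3 G k} {H : Subgroup G}

/-- The components of an object of `Z(H, α|_H)`, seen as a `G`-graded space supported in `H`. -/
def ZObj.gradeExt (X : ZObj.{u, v, w} (α.restrict H)) (g : G) : Submodule k X.carrier :=
  ⨆ hg : g ∈ H, X.grade ⟨g, hg⟩

/-- The component of degree `f` of `E(X)`: the maps `a : G → X` with `|a(x)| = x⁻¹ f x` and
`a(x h) = α(h⁻¹, x⁻¹ | f) h⁻¹.a(x)` for `x ∈ G`, `h ∈ H`. -/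
def transferHomog (X : ZObj.{u, v, w} (α.restrict H)) (f : G) :
    Submodule k (G → X.carrier) where
  carrier := {a | (∀ x, a x ∈ X.gradeExt (x⁻¹ * f * x)) ∧
    ∀ (x : G) (h : H), a (x * h) = (α.proj (h : G)⁻¹ x⁻¹ f : k) • X.act h⁻¹ (a x)}
  zero_mem' := ⟨fun _ => zero_mem _, fun _ _ => by simp⟩
  add_mem' ha hb := ⟨fun x => add_mem (ha.1 x) (hb.1 x), fun x h => by
    simp [ha.2 x h, hb.2 x h]⟩
  smul_mem' c a ha := ⟨fun x => Submodule.smul_mem _ _ (ha.1 x), fun x h => by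
    simp [ha.2 x h, smul_comm c]⟩

/-- `E(X)`, the sum of its homogeneous components in the space of all maps `G → X`. -/
def transferSpace (X : ZObj.{u, v, w} (α.restrict H)) : Submodule k (G → X.carrier) :=
  ⨆ f, transferHomog X f

lemma ZObj.mem_gradeExt {X : ZObj.{u, v, w} (α.restrict H)} {g : G} {x : X.carrier}
    (hx : x ∈ X.gradeExt g) : x = 0 ∨ ∃ hg : g ∈ H, x ∈ X.grade ⟨g, hg⟩ := by
  by_cases hg : g ∈ H
  · right
    exact ⟨hg, by simpa [gradeExt, hg] using hx⟩
  · left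
    simpa [gradeExt, hg] using hx

lemma ZObj.mem_gradeExt_of_mem {X : ZObj.{u, v, w} (α.restrict H)} {h : H} {g : G}
    {x : X.carrier} (hx : x ∈ X.grade h) (e : (h : G) = g) : x ∈ X.gradeExt g := by
  subst e
  simpa [gradeExt] using hx

variable [Finite G]

attribute [local instance] Fintype.ofFinite

/-- The component of degree `f` of a map `G → X`. -/
noncomputable def mapComp (X : ZObj.{u, v, w} (α.restrict H)) (f : G) :
    (G → X.carrier) →ₗ[k] (G → X.carrier) :=
  open Classical in
  LinearMap.pi fun x => ∑ u : H, (if x⁻¹ * f * x = u then (1 : k) else 0) •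
    (X.comp u ∘ₗ LinearMap.proj x)

/-- The action on maps `G → X`: `(g.a)(x) = α(x⁻¹, g | f)⁻¹ a(g⁻¹ x)` for `a` of degree `f`. It is
extended to all maps by linearity, using that the part of `a(g⁻¹ x)` of degree `u` comes from the
part of `a` of degree `f = g⁻¹ x u x⁻¹ g`. -/
noncomputable def mapAct (X : ZObj.{u, v, w} (α.restrict H)) (g : G) :
    (G → X.carrier) →ₗ[k] (G → X.carrier) :=
  LinearMap.pi fun x => ∑ u : H,
    (((α.proj x⁻¹ g (g⁻¹ * x * u * x⁻¹ * g))⁻¹ : kˣ) : k) •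
      (X.comp u ∘ₗ LinearMap.proj (g⁻¹ * x))

/-- The multiplication on maps `G → B`: `(ab)(x) = α(x⁻¹ | f, g) a(x) b(x)` for `a` of degree `f`
and `b` of degree `g`, extended to all maps by bilinearity. -/
noncomputable def mapMul (B : ZAlg.{u, v, w} (α.restrict H)) :
    (G → B.carrier) →ₗ[k] (G → B.carrier) →ₗ[k] (G → B.carrier) :=
  LinearMap.mk₂ k
    (fun a b x => ∑ u : H, ∑ t : H, (α.tens x⁻¹ (x * u * x⁻¹) (x * t * x⁻¹) : k) •
      B.mul (B.comp u (a x)) (B.comp t (b x)))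
    (fun _ _ _ => by ext; simp [Finset.sum_add_distrib])
    (fun c _ _ => by ext; simp [Finset.smul_sum, smul_comm c])
    (fun _ _ _ => by ext; simp [Finset.sum_add_distrib])
    (fun c _ _ => by ext; simp [Finset.smul_sum, smul_comm c])

lemma sum_smul_comp (X : ZObj.{u, v, w} (α.restrict H)) (c : H → k) (d : k) {g : G}
    {x : X.carrier} (hx : x ∈ X.gradeExt g) (hc : ∀ u : H, (u : G) = g → c u = d) :
    ∑ u : H, c u • X.comp u x = d • x := by
  classical
  obtain rfl | ⟨hg, hx⟩ := ZObj.mem_gradeExt hx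
  · simp
  · rw [Finset.sum_eq_single (⟨g, hg⟩ : H)]
    · rw [hc _ rfl, X.comp_of_mem hx, if_pos rfl]
    · intro u _ hu
      rw [X.comp_of_mem hx, if_neg hu, smul_zero]
    · simp

lemma mapComp_of_mem {X : ZObj.{u, v, w} (α.restrict H)} {f g : G} {a : G → X.carrier}
    (ha : a ∈ transferHomog X g) : mapComp X f a = open Classical in if f = g then a else 0 := by
  classical
  ext x
  have h := sum_smul_comp X (fun u : H => if x⁻¹ * f * x = u then (1 : k) else 0)
    (if f = g then 1 else 0) (ha.1 x) (fun u hu => by simp [hu])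
  simp only [mapComp, LinearMap.pi_apply, LinearMap.sum_apply, LinearMap.smul_apply,
    LinearMap.comp_apply, LinearMap.proj_apply]
  refine Eq.trans (by congr!) (h.trans ?_)
  split_ifs <;> simp

lemma mapAct_of_mem {X : ZObj.{u, v, w} (α.restrict H)} {f : G} {a : G → X.carrier}
    (ha : a ∈ transferHomog X f) (g x : G) :
    mapAct X g a x = (((α.proj x⁻¹ g f)⁻¹ : kˣ) : k) • a (g⁻¹ * x) := by
  have h := sum_smul_comp X
    (fun u : H => (((α.proj x⁻¹ g (g⁻¹ * x * u * x⁻¹ * g))⁻¹ : kˣ) : k))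
    (((α.proj x⁻¹ g f)⁻¹ : kˣ) : k) (ha.1 (g⁻¹ * x)) (fun u hu => by
      rw [hu]
      congr 3
      group)
  simpa [mapAct] using h

lemma mapMul_of_mem {B : ZAlg.{u, v, w} (α.restrict H)} {f g : G} {a b : G → B.carrier}
    (ha : a ∈ transferHomog B.toZObj f) (hb : b ∈ transferHomog B.toZObj g) (x : G) :
    mapMul B a b x = (α.tens x⁻¹ f g : k) • B.mul (a x) (b x) := by
  classical
  simp only [mapMul, LinearMap.mk₂_apply]
  obtain h0 | ⟨hf, hx⟩ := ZObj.mem_gradeExt (ha.1 x)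
  · simp [h0]
  obtain h0 | ⟨hg, hy⟩ := ZObj.mem_gradeExt (hb.1 x)
  · simp [h0]
  rw [Finset.sum_eq_single (⟨_, hf⟩ : H), Finset.sum_eq_single (⟨_, hg⟩ : H)]
  · rw [B.comp_of_mem hx, B.comp_of_mem hy, if_pos rfl, if_pos rfl]
    congr 3
    · group
    · group
  · intro t _ ht
    rw [B.comp_of_mem hy, if_neg ht]
    simp
  · simp
  · intro u _ hu
    rw [B.comp_of_mem hx, if_neg hu]
    simp
  · simp

lemma mapAct_mem {X : ZObj.{u, v, w} (α.restrict H)} {f : G} {a : G → X.carrier}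
    (ha : a ∈ transferHomog X f) (g : G) : mapAct X g a ∈ transferHomog X (g * f * g⁻¹) := by
  constructor
  · intro x
    rw [mapAct_of_mem ha]
    refine Submodule.smul_mem _ _ ?_
    convert ha.1 (g⁻¹ * x) using 2
    group
  · intro x h
    rw [mapAct_of_mem ha, mapAct_of_mem ha, ← mul_assoc, ha.2, map_smul, smul_smul, smul_smul,
      ← Units.val_mul, ← Units.val_mul]
    congr 2
    have := α.proj_proj (h : G)⁻¹ x⁻¹ g f
    simp only [mul_inv_rev, inv_inv]
    rw [inv_mul_eq_iff_eq_mul, ← mul_assoc, eq_mul_inv_iff_mul_eq]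
    exact this

lemma mapMul_mem {B : ZAlg.{u, v, w} (α.restrict H)} {f g : G} {a b : G → B.carrier}
    (ha : a ∈ transferHomog B.toZObj f) (hb : b ∈ transferHomog B.toZObj g) :
    mapMul B a b ∈ transferHomog B.toZObj (f * g) := by
  constructor
  · intro x
    rw [mapMul_of_mem ha hb]
    refine Submodule.smul_mem _ _ ?_
    obtain h0 | ⟨hf, hx⟩ := ZObj.mem_gradeExt (ha.1 x)
    · simp [h0]
    obtain h0 | ⟨hg, hy⟩ := ZObj.mem_gradeExt (hb.1 x)
    · simp [h0]
    exact ZObj.mem_gradeExt_of_mem (B.mul_mem _ _ _ hx _ hy) (by simp [mul_assoc])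
  · intro x h
    rw [mapMul_of_mem ha hb, mapMul_of_mem ha hb, ha.2, hb.2]
    obtain h0 | ⟨hf, hx⟩ := ZObj.mem_gradeExt (ha.1 x)
    · simp [h0]
    obtain h0 | ⟨hg, hy⟩ := ZObj.mem_gradeExt (hb.1 x)
    · simp [h0]
    rw [map_smul, map_smul, map_smul, LinearMap.smul_apply, B.act_mul _ _ _ _ hx _ hy]
    simp only [smul_smul, ← Units.val_mul]
    congr 2
    have := α.tens_proj (h : G)⁻¹ x⁻¹ f g
    simp only [inv_inv] at this
    simp only [mul_inv_rev, Cocycle3.tens_restrict, Subgroup.coe_inv]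
    rw [← mul_assoc, mul_right_comm, this, mul_assoc]

lemma transferSpace_induction {X : ZObj.{u, v, w} (α.restrict H)}
    {p : (G → X.carrier) → Prop} (mem : ∀ f, ∀ a ∈ transferHomog X f, p a) (zero : p 0)
    (add : ∀ a b, p a → p b → p (a + b)) {a : G → X.carrier} (ha : a ∈ transferSpace X) : p a :=
  Submodule.iSup_induction _ (motive := p) ha mem zero add

lemma transferHomog_le (X : ZObj.{u, v, w} (α.restrict H)) (f : G) :
    transferHomog X f ≤ transferSpace X := le_iSup _ f

lemma mapAct_mem_space (X : ZObj.{u, v, w} (α.restrict H)) (g : G) :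
    ∀ a ∈ transferSpace X, mapAct X g a ∈ transferSpace X := fun _ ha =>
  transferSpace_induction (p := fun a => mapAct X g a ∈ transferSpace X)
    (fun f _ ha => transferHomog_le X _ (mapAct_mem ha g)) (by simp)
    (fun a b ha hb => by rw [map_add]; exact add_mem ha hb) ha

lemma mapMul_mem_space (B : ZAlg.{u, v, w} (α.restrict H)) {a b : G → B.carrier}
    (ha : a ∈ transferSpace B.toZObj) (hb : b ∈ transferSpace B.toZObj) :
    mapMul B a b ∈ transferSpace B.toZObj := by
  refine transferSpace_induction (p := fun a => mapMul B a b ∈ transferSpace B.toZObj)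
    (fun f a ha => ?_) (by simp)
    (fun a b ha hb => by rw [map_add, LinearMap.add_apply]; exact add_mem ha hb) ha
  exact transferSpace_induction (p := fun b => mapMul B a b ∈ transferSpace B.toZObj)
    (fun g b hb => transferHomog_le _ _ (mapMul_mem ha hb)) (by simp)
    (fun a b ha hb => by rw [map_add]; exact add_mem ha hb) hb

lemma one_mem_transferHomog (B : ZAlg.{u, v, w} (α.restrict H)) :
    (fun _ : G => B.one) ∈ transferHomog B.toZObj 1 :=
  ⟨fun x => ZObj.mem_gradeExt_of_mem B.one_mem (by simp), fun x h => by
    simp [B.act_one, Cocycle3.proj, α.one_left, α.one_mid, α.one_right]⟩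

lemma iSupIndep_transfer (X : ZObj.{u, v, w} (α.restrict H)) :
    iSupIndep fun f => (transferHomog X f).comap (transferSpace X).subtype := by
  classical
  intro f
  rw [Submodule.disjoint_def]
  intro a ha ha'
  have h1 : (⨆ j, ⨆ (_ : j ≠ f), (transferHomog X j).comap (transferSpace X).subtype) ≤
      LinearMap.ker (mapComp X f ∘ₗ (transferSpace X).subtype) := by
    refine iSup₂_le fun j hj b hb => ?_
    rw [LinearMap.mem_ker, LinearMap.comp_apply, mapComp_of_mem hb, if_neg hj.symm]
  have h2 := h1 ha'
  rw [LinearMap.mem_ker, LinearMap.comp_apply, mapComp_of_mem ha, if_pos rfl] at h2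
  exact Subtype.ext h2

lemma iSup_transfer (X : ZObj.{u, v, w} (α.restrict H)) :
    ⨆ f, (transferHomog X f).comap (transferSpace X).subtype = ⊤ := by
  apply Submodule.map_injective_of_injective (transferSpace X).injective_subtype
  simp only [Submodule.map_iSup, Submodule.map_comap_subtype, Submodule.map_top,
    Submodule.range_subtype]
  refine le_antisymm (iSup_le fun f => inf_le_left) ?_
  exact iSup_mono fun f => le_inf (transferHomog_le X f) le_rfl

lemma mapAct_one (X : ZObj.{u, v, w} (α.restrict H)) {a : G → X.carrier}
    (ha : a ∈ transferSpace X) : mapAct X 1 a = a :=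
  transferSpace_induction (p := fun a => mapAct X 1 a = a)
    (fun f a ha => by
      ext x
      rw [mapAct_of_mem ha]
      simp [Cocycle3.proj, α.one_mid, α.one_right])
    (by simp) (fun a b ha hb => by rw [map_add, ha, hb]) ha

lemma mapAct_mul {X : ZObj.{u, v, w} (α.restrict H)} {f : G} {a : G → X.carrier}
    (ha : a ∈ transferHomog X f) (g h : G) :
    mapAct X (g * h) a = (α.proj g h f : k) • mapAct X g (mapAct X h a) := by
  ext x
  rw [Pi.smul_apply, mapAct_of_mem ha, mapAct_of_mem (mapAct_mem ha h), mapAct_of_mem ha,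
    smul_smul, smul_smul, ← Units.val_mul, ← Units.val_mul]
  have := α.proj_proj x⁻¹ g h f
  congr 2
  · simp only [mul_inv_rev, inv_inv]
    rw [inv_eq_iff_eq_inv, eq_inv_iff_mul_eq_one, ← mul_assoc, ← mul_assoc, this]
    apply Additive.ofMul.injective
    simp only [ofMul_mul, ofMul_inv, ofMul_one]
    abel
  · simp [mul_assoc]

/-- The transfer `E(X)` of an object `X` of `Z(H, α|_H)`, an object of `Z(G, α)`. -/
noncomputable def transferObj (X : ZObj.{u, v, w} (α.restrict H)) : ZObj.{u, v, max v w} α where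
  carrier := transferSpace X
  grade f := (transferHomog X f).comap (transferSpace X).subtype
  indep := iSupIndep_transfer X
  iSup_grade := iSup_transfer X
  act g := (mapAct X g).restrict (mapAct_mem_space X g)
  act_bijective := bijective_of_projective α (iSup_transfer X)
    (fun a => Subtype.ext (mapAct_one X a.2)) (fun g _ _ ha => mapAct_mem ha g)
    (fun g h _ _ ha => Subtype.ext (mapAct_mul ha g h))
  map_act := map_eq_of_projective α
    (fun a => Subtype.ext (mapAct_one X a.2)) (fun g _ _ ha => mapAct_mem ha g)
    (fun g h _ _ ha => Subtype.ext (mapAct_mul ha g h))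
  act_act g h _ _ ha := Subtype.ext (mapAct_mul ha g h)

lemma mapAct_mapMul {B : ZAlg.{u, v, w} (α.restrict H)} {g h : G} {a b : G → B.carrier}
    (ha : a ∈ transferHomog B.toZObj g) (hb : b ∈ transferHomog B.toZObj h) (f : G) :
    mapAct B.toZObj f (mapMul B a b) =
      (α.tens f g h : k) • mapMul B (mapAct B.toZObj f a) (mapAct B.toZObj f b) := by
  ext x
  rw [Pi.smul_apply, mapAct_of_mem (mapMul_mem ha hb), mapMul_of_mem ha hb,
    mapMul_of_mem (mapAct_mem ha f) (mapAct_mem hb f), mapAct_of_mem ha, mapAct_of_mem hb,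
    map_smul, map_smul, LinearMap.smul_apply]
  simp only [smul_smul, ← Units.val_mul]
  congr 2
  have := α.tens_proj x⁻¹ f g h
  simp only [mul_inv_rev, inv_inv]
  rw [inv_mul_eq_iff_eq_mul]
  simp only [← mul_assoc]
  rw [eq_mul_inv_iff_mul_eq, eq_mul_inv_iff_mul_eq, this]

lemma mapMul_assoc {B : ZAlg.{u, v, w} (α.restrict H)} {f g h : G} {a b c : G → B.carrier}
    (ha : a ∈ transferHomog B.toZObj f) (hb : b ∈ transferHomog B.toZObj g)
    (hc : c ∈ transferHomog B.toZObj h) :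
    mapMul B a (mapMul B b c) = (α f g h : k) • mapMul B (mapMul B a b) c := by
  ext x
  rw [Pi.smul_apply, mapMul_of_mem ha (mapMul_mem hb hc), mapMul_of_mem (mapMul_mem ha hb) hc,
    mapMul_of_mem ha hb, mapMul_of_mem hb hc]
  obtain h0 | ⟨hf, hx⟩ := ZObj.mem_gradeExt (ha.1 x)
  · simp [h0]
  obtain h0 | ⟨hg, hy⟩ := ZObj.mem_gradeExt (hb.1 x)
  · simp [h0]
  obtain h0 | ⟨hh, hz⟩ := ZObj.mem_gradeExt (hc.1 x)
  · simp [h0]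
  rw [map_smul, B.mul_assoc _ _ _ _ hx _ hy _ hz, map_smul, LinearMap.smul_apply]
  simp only [smul_smul, ← Units.val_mul]
  congr 2
  have := α.tens_tens x⁻¹ f g h
  simp only [inv_inv] at this
  rw [← mul_assoc, ← mul_assoc]
  exact this.symm

/-- The multiplication of maps, restricted to `E(B)`. -/
noncomputable def transferMul (B : ZAlg.{u, v, w} (α.restrict H)) :
    transferSpace B.toZObj →ₗ[k] transferSpace B.toZObj →ₗ[k] transferSpace B.toZObj :=
  LinearMap.mk₂ k (fun a b => ⟨mapMul B a b, mapMul_mem_space B a.2 b.2⟩)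
    (fun _ _ _ => Subtype.ext (by simp)) (fun _ _ _ => Subtype.ext (by simp))
    (fun _ _ _ => Subtype.ext (by simp)) (fun _ _ _ => Subtype.ext (by simp))

/-- The transfer `E(B)` of an algebra `B` in `Z(H, α|_H)`, an algebra in `Z(G, α)`. -/
noncomputable def transfer (B : ZAlg.{u, v, w} (α.restrict H)) : ZAlg.{u, v, max v w} α where
  toZObj := transferObj B.toZObj
  mul := transferMul B
  one := ⟨fun _ => B.one, transferHomog_le _ _ (one_mem_transferHomog B)⟩
  mul_mem f g a ha b hb := mapMul_mem ha hb
  act_mul f g h a ha b hb := Subtype.ext (mapAct_mapMul ha hb f)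
  one_mem := one_mem_transferHomog B
  act_one f := by
    refine Subtype.ext (funext fun x => ?_)
    refine (mapAct_of_mem (one_mem_transferHomog B) f x).trans ?_
    simp [Cocycle3.proj, α.one_mid, α.one_right, α.one_left]
  mul_assoc f g h a ha b hb c hc := Subtype.ext (mapMul_assoc ha hb hc)
  one_mul a := by
    refine Subtype.ext ?_
    change mapMul B (fun _ => B.one) a.1 = a.1
    refine transferSpace_induction (p := fun a => mapMul B (fun _ => B.one) a = a)
      (fun f a ha => ?_) (by simp) (fun a b ha hb => by rw [map_add, ha, hb]) a.2
    ext x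
    rw [mapMul_of_mem (one_mem_transferHomog B) ha, B.one_mul]
    simp [Cocycle3.tens, α.one_mid, α.one_left]
  mul_one a := by
    refine Subtype.ext ?_
    change mapMul B a.1 (fun _ => B.one) = a.1
    refine transferSpace_induction (p := fun a => mapMul B a (fun _ => B.one) = a)
      (fun f a ha => ?_) (by simp)
      (fun a b ha hb => by rw [map_add, LinearMap.add_apply, ha, hb]) a.2
    ext x
    rw [mapMul_of_mem ha (one_mem_transferHomog B), B.mul_one]
    simp [Cocycle3.tens, α.one_mid, α.one_right]

/-- The algebra `A(H, F, γ, ε) = E(k[F, γ, ε])` in `Z(G, α)`. -/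
noncomputable def etaleAlg (α : Cocycle3 G k) (H : Subgroup G) (F : Subgroup H) [F.Normal]
    (γ : F → F → kˣ) (ε : H → F → kˣ) (h : IsCompatible (α.restrict H) F γ ε) :
    ZAlg.{u, v, max u v} α :=
  transfer (twistedGroupAlg h)

end Transfer

end TwistedCentre

/-!
In an étale algebra `A` the component of degree `1` is a reduced commutative finite-dimensional
`k`-algebra: a nilpotent element would be orthogonal to everything under the trace form. Hence it
is a product of copies of `k`, whose primitive idempotents (the points of `A`) are permuted by `G`.
Fix a point `p` with stabiliser `H`. The sum of the orbit of `p` is an invariant idempotent, so it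
is `1` by indecomposability.

Commutativity gives `p a = a p = (f.p) a` for `a` of degree `f`. Since distinct points are
orthogonal, this forces `f ∈ H` unless `p a = 0`. By nondegeneracy of the trace form, every
nonzero homogeneous element of the ideal `p A` divides `p`. So the components of `p A` are at most
one-dimensional, the degrees that occur form a normal subgroup `F` of `H`, and the structure
constants of a homogeneous basis are `γ` and `ε`. Finally, as the translates of `p` are orthogonal
with sum `1`, the map `a ↦ (x ↦ p (x⁻¹.a))` is an isomorphism from `A` to `E(p A)`.
-/

namespace TwistedCentre

variable {G : Type v} [Group G] {k : Type u} [Field k] {α : Cocycle3 G k}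

namespace Cocycle3

variable (α)

lemma proj_one_right (f g : G) : α.proj f g 1 = 1 := by
  simp [proj, α.one_left, α.one_mid, α.one_right]

lemma tens_one_mid (f g : G) : α.tens f 1 g = 1 := by
  simp [tens, α.one_left, α.one_mid]

end Cocycle3

namespace ZObj

variable (X : ZObj.{u, v, w} α)

lemma act_eq_zero_iff {f : G} {x : X.carrier} : X.act f x = 0 ↔ x = 0 :=
  map_eq_zero_iff _ (X.act_bijective f).1

lemma act_mem_one {c : X.carrier} (hc : c ∈ X.grade 1) (f : G) : X.act f c ∈ X.grade 1 := by
  simpa using X.act_mem f hc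

lemma act_act_of_mem_one {c : X.carrier} (hc : c ∈ X.grade 1) (f g : G) :
    X.act (f * g) c = X.act f (X.act g c) := by
  rw [X.act_act f g 1 c hc, α.proj_one_right, Units.val_one, one_smul]

variable {X} {M : Type*} [AddCommGroup M] [Module k M]

lemma map_mem_of_forall_mem_grade {φ : X.carrier →ₗ[k] M} {N : Submodule k M}
    (h : ∀ g, ∀ x ∈ X.grade g, φ x ∈ N) (x : X.carrier) : φ x ∈ N := by
  have : ⨆ g, X.grade g ≤ N.comap φ := iSup_le h
  exact this (X.iSup_grade ▸ Submodule.mem_top)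

lemma hom_ext {φ ψ : X.carrier →ₗ[k] M} (h : ∀ g, ∀ x ∈ X.grade g, φ x = ψ x) : φ = ψ :=
  LinearMap.eqLocus_eq_top.1 (top_unique (X.iSup_grade ▸ iSup_le h))

lemma hom_ext₂ {Y : ZObj.{u, v, w'} α} {φ ψ : X.carrier →ₗ[k] Y.carrier →ₗ[k] M}
    (h : ∀ f g, ∀ x ∈ X.grade f, ∀ y ∈ Y.grade g, φ x y = ψ x y) : φ = ψ :=
  hom_ext fun f x hx ↦ hom_ext fun g y hy ↦ h f g x hx y hy

end ZObj

namespace ZAlg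

variable (A : ZAlg.{u, v, w} α)

lemma mul_mem_of_left_mem_one {c x : A.carrier} {g : G} (hc : c ∈ A.grade 1)
    (hx : x ∈ A.grade g) : A.mul c x ∈ A.grade g := by
  simpa using A.mul_mem 1 g c hc x hx

lemma mul_assoc_of_left_mem_one {c : A.carrier} (hc : c ∈ A.grade 1) (x y : A.carrier) :
    A.mul c (A.mul x y) = A.mul (A.mul c x) y := by
  have : A.mul.compr₂ (A.mul c) = A.mul ∘ₗ A.mul c := ZObj.hom_ext₂ fun f g x hx y hy ↦ by
    simpa [α.one_left] using A.mul_assoc 1 f g c hc x hx y hy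
  exact LinearMap.congr_fun₂ this x y

lemma mul_assoc_of_mid_mem_one {c : A.carrier} (hc : c ∈ A.grade 1) (x y : A.carrier) :
    A.mul x (A.mul c y) = A.mul (A.mul x c) y := by
  have : A.mul.compl₂ (A.mul c) = A.mul ∘ₗ A.mul.flip c := ZObj.hom_ext₂ fun f g x hx y hy ↦ by
    simpa [α.one_mid] using A.mul_assoc f 1 g x hx c hc y hy
  exact LinearMap.congr_fun₂ this x y

lemma act_mul_of_left_mem_one {c : A.carrier} (hc : c ∈ A.grade 1) (f : G) (x : A.carrier) :
    A.act f (A.mul c x) = A.mul (A.act f c) (A.act f x) := by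
  have : A.act f ∘ₗ A.mul c = A.mul (A.act f c) ∘ₗ A.act f := ZObj.hom_ext fun g x hx ↦ by
    simpa [α.tens_one_mid] using A.act_mul f 1 g c hc x hx
  exact LinearMap.congr_fun this x

instance gradeOneRing : Ring (A.grade 1) where
  __ := (inferInstance : AddCommGroup (A.grade 1))
  mul x y := ⟨A.mul x y, A.mul_mem_of_left_mem_one x.2 y.2⟩
  one := ⟨A.one, A.one_mem⟩
  left_distrib x _ _ := Subtype.ext (map_add (A.mul x) _ _)
  right_distrib _ _ z := Subtype.ext (LinearMap.map_add₂ A.mul _ _ z)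
  zero_mul x := Subtype.ext (LinearMap.map_zero₂ A.mul x)
  mul_zero x := Subtype.ext (map_zero (A.mul x))
  mul_assoc x y z := Subtype.ext (A.mul_assoc_of_left_mem_one x.2 y z).symm
  one_mul x := Subtype.ext (A.one_mul x)
  mul_one x := Subtype.ext (A.mul_one x)

instance gradeOneAlgebra : Algebra k (A.grade 1) :=
  Algebra.ofModule (fun r x y ↦ Subtype.ext (LinearMap.map_smul₂ A.mul r x.1 y.1))
    (fun r x y ↦ Subtype.ext (map_smul (A.mul x) r y.1))

/-- The component of degree `1` acting on the whole algebra by left multiplication. -/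
def gradeOneLmul : A.grade 1 →ₐ[k] Module.End k A.carrier :=
  AlgHom.ofLinearMap (A.mul ∘ₗ (A.grade 1).subtype) (LinearMap.ext A.one_mul)
    fun x y ↦ LinearMap.ext fun z ↦ (A.mul_assoc_of_left_mem_one x.2 y z).symm

instance [Nontrivial A.carrier] : Nontrivial (A.grade 1) where
  exists_pair_ne := by
    obtain ⟨x, hx⟩ := exists_ne (0 : A.carrier)
    refine ⟨1, 0, fun h ↦ hx ?_⟩
    have h_one : A.one = 0 := congrArg Subtype.val h
    rw [← A.one_mul x, h_one, LinearMap.map_zero₂]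

variable {A}

lemma IsCommutative.mul_comm_of_mem_one (hc : A.IsCommutative) {c : A.carrier}
    (hc_one : c ∈ A.grade 1) (x : A.carrier) : A.mul c x = A.mul x c := by
  rw [hc 1 c hc_one x, A.act_one_apply]

/-- The component of degree `1` of a commutative algebra is an ordinary commutative ring, because
elements of degree `1` braid trivially. -/
@[reducible] def IsCommutative.gradeOneCommRing (hc : A.IsCommutative) : CommRing (A.grade 1) where
  toRing := A.gradeOneRing
  mul_comm x y := Subtype.ext (hc.mul_comm_of_mem_one x.2 y)

section Separable

open Classical in
lemma trace_eq_zero_of_mem {g : G} (hg : g ≠ 1) {x : A.carrier} (hx : x ∈ A.grade g) :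
    A.trace x = 0 :=
  LinearMap.trace_eq_zero_of_mapsTo_ne (N := A.grade) A.bijective_coe (fun h ↦ g * h)
    (fun h e ↦ hg (by simpa using e)) (fun h y hy ↦ A.mul_mem g h x hx y hy)

lemma IsSeparable.exists_trace_mul_ne_zero (hs : A.IsSeparable) {f : G} {x : A.carrier}
    (hx : x ∈ A.grade f) (hx0 : x ≠ 0) : ∃ y ∈ A.grade f⁻¹, A.trace (A.mul x y) ≠ 0 := by
  by_contra! h_trace
  have h_form : A.traceForm x = 0 := ZObj.hom_ext fun g y hy ↦ by
    by_cases hg : g = f⁻¹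
    · exact h_trace y (hg ▸ hy)
    · exact trace_eq_zero_of_mem (fun e ↦ hg (eq_inv_of_mul_eq_one_right e))
        (A.mul_mem f g x hx y hy)
  exact hx0 (hs.1 x (LinearMap.congr_fun h_form))

lemma IsSeparable.isReduced_grade_one (hs : A.IsSeparable) (hc : A.IsCommutative) :
    IsReduced (A.grade 1) where
  eq_zero x hx := by
    by_contra hx0
    obtain ⟨y, hy, hxy⟩ := hs.exists_trace_mul_ne_zero x.2 fun e ↦ hx0 (Subtype.ext e)
    rw [inv_one] at hy
    have hcomm : Commute x ⟨y, hy⟩ := hc.gradeOneCommRing.mul_comm _ _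
    have hnil := (hcomm.isNilpotent_mul_right hx).map A.gradeOneLmul
    exact hxy (LinearMap.isNilpotent_trace_of_isNilpotent hnil).eq_zero

end Separable

end ZAlg

/-- The primitive idempotent `p` cuts out one factor `R ⧸ M = k` of the reduced Artinian ring
`R`. -/
lemma exists_isIdempotentElem_forall_mul_eq_smul (k R : Type*) [Field k] [IsAlgClosed k]
    [CommRing R] [Nontrivial R] [IsReduced R] [Algebra k R] [FiniteDimensional k R] :
    ∃ p : R, p ≠ 0 ∧ IsIdempotentElem p ∧ ∀ c, ∃ t : k, c * p = t • p := by
  classical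
  have : IsArtinianRing R := IsArtinianRing.of_finite k R
  obtain ⟨M⟩ : Nonempty (MaximalSpectrum R) := inferInstance
  have := M.isMaximal
  let e := IsArtinianRing.equivPi R
  refine ⟨e.symm (Pi.single M 1), ?_, ?_, fun c ↦ ?_⟩
  · simp [Pi.single_eq_zero_iff]
  · rw [IsIdempotentElem, ← map_mul, ← Pi.single_mul, mul_one]
  · obtain ⟨t, ht⟩ := (IsAlgClosed.algebraMap_bijective_of_isIntegral (k := k)
      (K := R ⧸ M.asIdeal)).2 (Ideal.Quotient.mk _ c)
    refine ⟨t, e.injective ?_⟩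
    have h_mul (r : R) : e (r * e.symm (Pi.single M 1)) = Pi.single M (Ideal.Quotient.mk _ r) := by
      rw [map_mul, e.apply_symm_apply, ← Pi.single_mul_right, mul_one]
      rfl
    rw [Algebra.smul_def, h_mul, h_mul, ← ht]
    rfl

namespace ZAlg

variable {A : ZAlg.{u, v, w} α}

/-- A point of the spectrum of the component of degree `1`, given by the primitive idempotent that
cuts out a factor `k`. -/
@[ext]
structure Point (A : ZAlg.{u, v, w} α) where
  val : A.carrier
  mem_one : val ∈ A.grade 1
  ne_zero : val ≠ 0
  mul_self : A.mul val val = val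
  exists_mul_eq_smul : ∀ c ∈ A.grade 1, ∃ t : k, A.mul c val = t • val

instance : CoeOut A.Point A.carrier := ⟨Point.val⟩

lemma IsSeparable.nonempty_point [IsAlgClosed k] [Nontrivial A.carrier] (hs : A.IsSeparable)
    (hc : A.IsCommutative) : Nonempty A.Point := by
  let := hc.gradeOneCommRing
  have : IsReduced (A.grade 1) := hs.isReduced_grade_one hc
  obtain ⟨p, hp0, hpp, hp⟩ := exists_isIdempotentElem_forall_mul_eq_smul k (A.grade 1)
  exact ⟨{
    val := p
    mem_one := p.2
    ne_zero := fun h ↦ hp0 (Subtype.ext h)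
    mul_self := congrArg Subtype.val hpp
    exists_mul_eq_smul := fun c hc ↦ (hp ⟨c, hc⟩).imp fun _ ht ↦ congrArg Subtype.val ht }⟩

instance : SMul G A.Point where
  smul g p :=
    { val := A.act g p
      mem_one := A.act_mem_one p.mem_one g
      ne_zero := A.act_eq_zero_iff.not.2 p.ne_zero
      mul_self := by rw [← A.act_mul_of_left_mem_one p.mem_one, p.mul_self]
      exists_mul_eq_smul := fun c hc ↦ by
        obtain ⟨t, ht⟩ := p.exists_mul_eq_smul _ (A.act_mem_one hc g⁻¹)
        refine ⟨t, ?_⟩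
        rw [← map_smul, ← ht, A.act_mul_of_left_mem_one (A.act_mem_one hc _),
          ← A.act_act_of_mem_one hc, mul_inv_cancel, A.act_one_apply] }

lemma Point.val_smul (g : G) (p : A.Point) : (g • p).val = A.act g p := rfl

instance : MulAction G A.Point where
  one_smul p := Point.ext (A.act_one_apply p)
  mul_smul f g p := Point.ext (A.act_act_of_mem_one p.mem_one f g)

namespace Point

variable (p : A.Point)

lemma mul_mul (x : A.carrier) : A.mul p (A.mul p x) = A.mul p x := by
  rw [A.mul_assoc_of_left_mem_one p.mem_one, p.mul_self]

lemma act_inv_mul_smul (g : G) (x : A.carrier) :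
    A.act g⁻¹ (A.mul (g • p).val x) = A.mul p (A.act g⁻¹ x) := by
  rw [A.act_mul_of_left_mem_one (g • p).mem_one, ← val_smul, inv_smul_smul]

lemma mul_act {g : G} (hg : g ∈ MulAction.stabilizer G p) (x : A.carrier) :
    A.mul p (A.act g x) = A.act g (A.mul p x) := by
  rw [A.act_mul_of_left_mem_one p.mem_one, ← val_smul, hg]

variable {p}

lemma mul_eq_of_mul_ne_zero {q : A.Point} (h : A.mul p q ≠ 0) : A.mul p q = q := by
  obtain ⟨t, ht⟩ := q.exists_mul_eq_smul p p.mem_one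
  have h_smul : t • A.mul p q = A.mul p q := by rw [← map_smul, ← ht, p.mul_mul]
  rw [ht, smul_left_injective k h (h_smul.trans (one_smul k _).symm), one_smul]

lemma mul_eq_zero (hc : A.IsCommutative) {q : A.Point} (hpq : p ≠ q) : A.mul p q = 0 := by
  by_contra h
  have h_comm := hc.mul_comm_of_mem_one p.mem_one q
  exact hpq (Point.ext (by
    rw [← mul_eq_of_mul_ne_zero (h_comm ▸ h), ← h_comm, mul_eq_of_mul_ne_zero h]))

lemma mem_stabilizer_of_mul_ne_zero (hc : A.IsCommutative) {f : G} {x : A.carrier}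
    (hx : x ∈ A.grade f) (h : A.mul p x ≠ 0) : f ∈ MulAction.stabilizer G p := by
  by_contra hf
  refine h ?_
  have h_swap : A.mul p x = A.mul (f • p).val x := by
    rw [hc.mul_comm_of_mem_one p.mem_one, hc f x hx, val_smul]
  rw [← p.mul_mul, h_swap, A.mul_assoc_of_left_mem_one p.mem_one, mul_eq_zero hc (Ne.symm hf),
    LinearMap.map_zero₂]

end Point

section Indecomposable

lemma IsCommutative.isIdeal_range_mul (hc : A.IsCommutative) {c : A.carrier}
    (hc_one : c ∈ A.grade 1) (h_act : ∀ g, A.act g c = c) :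
    A.IsIdeal (LinearMap.range (A.mul c)) where
  graded := by
    rintro _ ⟨x, rfl⟩
    refine ZObj.map_mem_of_forall_mem_grade (fun g x hx ↦ Submodule.mem_iSup_of_mem g ?_) x
    exact ⟨⟨x, rfl⟩, A.mul_mem_of_left_mem_one hc_one hx⟩
  act_mem g := by
    rintro _ ⟨x, rfl⟩
    exact ⟨A.act g x, by rw [A.act_mul_of_left_mem_one hc_one, h_act]⟩
  mul_mem_left y := by
    rintro _ ⟨x, rfl⟩
    refine ⟨A.mul y x, ?_⟩
    rw [A.mul_assoc_of_left_mem_one hc_one, hc.mul_comm_of_mem_one hc_one,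
      A.mul_assoc_of_mid_mem_one hc_one]
  mul_mem_right y := by
    rintro _ ⟨x, rfl⟩
    exact ⟨A.mul x y, A.mul_assoc_of_left_mem_one hc_one x y⟩

lemma IsIndecomposable.eq_one_of_act_eq (hi : A.IsIndecomposable) (hc : A.IsCommutative)
    {c : A.carrier} (hc_one : c ∈ A.grade 1) (h_act : ∀ g, A.act g c = c)
    (h_idem : A.mul c c = c) (h0 : c ≠ 0) : c = A.one := by
  have h_mul (x : A.carrier) : A.mul c (A.mul c x) = A.mul c x := by
    rw [A.mul_assoc_of_left_mem_one hc_one, h_idem]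
  have h_compl_mul (x : A.carrier) : A.mul (A.one - c) x = x - A.mul c x := by
    rw [LinearMap.map_sub₂, A.one_mul]
  have h_isCompl :
      IsCompl (LinearMap.range (A.mul c)) (LinearMap.range (A.mul (A.one - c))) := by
    refine ⟨Submodule.disjoint_def.2 ?_, codisjoint_iff_le_sup.2 fun x _ ↦ ?_⟩
    · rintro _ ⟨x, rfl⟩ ⟨y, hy⟩
      rw [← h_mul x, ← hy, h_compl_mul, map_sub, h_mul, sub_self]
    · exact Submodule.mem_sup.2 ⟨_, ⟨x, rfl⟩, _, ⟨x, rfl⟩, by rw [h_compl_mul]; abel⟩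
  obtain h_bot | h_bot := hi.2 _ _ (hc.isIdeal_range_mul hc_one h_act)
    (hc.isIdeal_range_mul (sub_mem A.one_mem hc_one) fun g ↦ by rw [map_sub, A.act_one, h_act])
    h_isCompl
  · have h_zero := LinearMap.congr_fun (LinearMap.range_eq_bot.1 h_bot) c
    exact absurd (h_idem.symm.trans h_zero) h0
  · have h_zero := LinearMap.congr_fun (LinearMap.range_eq_bot.1 h_bot) A.one
    exact (sub_eq_zero.1 ((A.mul_one _).symm.trans h_zero)).symm

/-- The sum is a `G`-invariant idempotent of degree `1`, hence trivial as `A` is indecomposable. -/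
lemma Point.sum_orbit (hi : A.IsIndecomposable) (hc : A.IsCommutative) (p : A.Point)
    [Fintype (MulAction.orbit G p)] : ∑ q : MulAction.orbit G p, q.1.val = A.one := by
  set c := ∑ q : MulAction.orbit G p, q.1.val with hc_def
  have h_mul (q : MulAction.orbit G p) : A.mul c q.1 = q.1 := by
    rw [hc_def, LinearMap.map_sum₂, Finset.sum_eq_single q _ (by simp), q.1.mul_self]
    exact fun r _ hr ↦ mul_eq_zero hc (Subtype.val_injective.ne hr)
  refine hi.eq_one_of_act_eq hc (sum_mem fun q _ ↦ q.1.mem_one) (fun g ↦ ?_) ?_ fun h0 ↦ ?_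
  · rw [hc_def, map_sum]
    exact Equiv.sum_comp (MulAction.toPerm g) fun q : MulAction.orbit G p ↦ q.1.val
  · conv_lhs => rw [hc_def, map_sum, ← hc_def]
    exact Finset.sum_congr rfl fun q _ ↦ h_mul q
  · refine p.ne_zero ?_
    rw [← h_mul ⟨p, MulAction.mem_orbit_self p⟩, h0, LinearMap.map_zero₂]

end Indecomposable

namespace Point

/-- The component of degree `g` of the ideal `pA`. -/
def component (p : A.Point) (g : G) : Submodule k A.carrier where
  carrier := {x | x ∈ A.grade g ∧ A.mul p x = x}
  zero_mem' := ⟨zero_mem _, map_zero _⟩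
  add_mem' hx hy := ⟨add_mem hx.1 hy.1, by rw [map_add, hx.2, hy.2]⟩
  smul_mem' c _ hx := ⟨Submodule.smul_mem _ c hx.1, by rw [map_smul, hx.2]⟩

variable {p : A.Point}

lemma val_mem_component : p.val ∈ p.component 1 := ⟨p.mem_one, p.mul_self⟩

lemma mul_mem_component_of_mem_grade {g : G} {x : A.carrier} (hx : x ∈ A.grade g) :
    A.mul p x ∈ p.component g :=
  ⟨A.mul_mem_of_left_mem_one p.mem_one hx, p.mul_mul x⟩

lemma mul_mem_component {f g : G} {x y : A.carrier} (hx : x ∈ p.component f)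
    (hy : y ∈ A.grade g) : A.mul x y ∈ p.component (f * g) :=
  ⟨A.mul_mem f g x hx.1 y hy, by rw [A.mul_assoc_of_left_mem_one p.mem_one, hx.2]⟩

lemma act_mem_component {g : G} (hg : g ∈ MulAction.stabilizer G p) {f : G} {x : A.carrier}
    (hx : x ∈ p.component f) : A.act g x ∈ p.component (g * f * g⁻¹) :=
  ⟨A.act_mem g hx.1, by rw [p.mul_act hg, hx.2]⟩

lemma mul_val_of_mem_component (hc : A.IsCommutative) {f : G} {x : A.carrier}
    (hx : x ∈ p.component f) : A.mul x p = x := by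
  rw [← hc.mul_comm_of_mem_one p.mem_one, hx.2]

lemma mem_stabilizer_of_mem_component (hc : A.IsCommutative) {f : G} {x : A.carrier}
    (hx : x ∈ p.component f) (h0 : x ≠ 0) : f ∈ MulAction.stabilizer G p :=
  mem_stabilizer_of_mul_ne_zero hc hx.1 (hx.2.symm ▸ h0)

lemma exists_mul_right_eq_val (hc : A.IsCommutative) (hs : A.IsSeparable) {f : G} {x : A.carrier}
    (hx : x ∈ p.component f) (h0 : x ≠ 0) : ∃ y ∈ p.component f⁻¹, A.mul x y = p := by
  obtain ⟨y, hy, h_trace⟩ := hs.exists_trace_mul_ne_zero hx.1 h0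
  have hxy := mul_mem_component hx hy
  rw [mul_inv_cancel] at hxy
  obtain ⟨t, ht⟩ := p.exists_mul_eq_smul _ hxy.1
  rw [mul_val_of_mem_component hc hxy] at ht
  have ht0 : t ≠ 0 := by
    rintro rfl
    exact h_trace (by rw [ht, zero_smul, map_zero])
  refine ⟨t⁻¹ • A.mul p y, Submodule.smul_mem _ _ (mul_mem_component_of_mem_grade hy), ?_⟩
  rw [map_smul, A.mul_assoc_of_mid_mem_one p.mem_one, mul_val_of_mem_component hc hx, ht,
    inv_smul_smul₀ ht0]

lemma exists_mul_left_eq_val (hc : A.IsCommutative) (hs : A.IsSeparable) {f : G} {x : A.carrier}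
    (hx : x ∈ p.component f) (h0 : x ≠ 0) : ∃ y ∈ p.component f⁻¹, A.mul y x = p := by
  obtain ⟨y, hy, hxy⟩ := exists_mul_right_eq_val hc hs hx h0
  refine ⟨A.act f y, ?_, by rw [← hc f x hx.1, hxy]⟩
  simpa using act_mem_component (mem_stabilizer_of_mem_component hc hx h0) hy

lemma mul_ne_zero (hc : A.IsCommutative) (hs : A.IsSeparable) {f g : G} {x z : A.carrier}
    (hx : x ∈ p.component f) (hx0 : x ≠ 0) (hz : z ∈ p.component g) (hz0 : z ≠ 0) :
    A.mul x z ≠ 0 := by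
  obtain ⟨y, hy, hyx⟩ := exists_mul_left_eq_val hc hs hx hx0
  intro h0
  have h_assoc := A.mul_assoc _ _ _ y hy.1 x hx.1 z hz.1
  rw [h0, map_zero, hyx, hz.2] at h_assoc
  exact smul_ne_zero (Units.ne_zero _) hz0 h_assoc.symm

lemma exists_eq_smul (hc : A.IsCommutative) (hs : A.IsSeparable) {f : G} {x z : A.carrier}
    (hx : x ∈ p.component f) (hx0 : x ≠ 0) (hz : z ∈ p.component f) : ∃ t : k, z = t • x := by
  obtain ⟨y, hy, hxy⟩ := exists_mul_right_eq_val hc hs hx hx0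
  have hyz := mul_mem_component hy hz.1
  rw [inv_mul_cancel] at hyz
  obtain ⟨t, ht⟩ := p.exists_mul_eq_smul _ hyz.1
  rw [mul_val_of_mem_component hc hyz] at ht
  have h_assoc := A.mul_assoc _ _ _ x hx.1 y hy.1 z hz.1
  rw [ht, map_smul, mul_val_of_mem_component hc hx, hxy, hz.2] at h_assoc
  exact ⟨((α f f⁻¹ f)⁻¹ : kˣ) * t, by rw [mul_smul, h_assoc, smul_smul, Units.inv_mul, one_smul]⟩

/-- The degrees that occur in the ideal `pA`. They lie in the stabiliser of `p`, and are encoded as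
a subgroup of it. -/
def support (p : A.Point) (hc : A.IsCommutative) (hs : A.IsSeparable) :
    Subgroup (MulAction.stabilizer G p) where
  carrier := {f | ∃ x ∈ p.component (f : G), x ≠ 0}
  one_mem' := ⟨p, val_mem_component, p.ne_zero⟩
  mul_mem' := by
    rintro f g ⟨x, hx, hx0⟩ ⟨y, hy, hy0⟩
    exact ⟨A.mul x y, mul_mem_component hx hy.1, mul_ne_zero hc hs hx hx0 hy hy0⟩
  inv_mem' := by
    rintro f ⟨x, hx, hx0⟩
    obtain ⟨y, hy, hxy⟩ := exists_mul_right_eq_val hc hs hx hx0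
    exact ⟨y, hy, fun h0 ↦ p.ne_zero (by rw [← hxy, h0, map_zero])⟩

instance support_normal (hc : A.IsCommutative) (hs : A.IsSeparable) :
    (p.support hc hs).Normal where
  conj_mem := by
    rintro f ⟨x, hx, hx0⟩ g
    exact ⟨A.act g x, act_mem_component g.2 hx, A.act_eq_zero_iff.not.2 hx0⟩

/-- A homogeneous basis of the ideal `pA` that contains `p`. Since the components of `pA` are at
most one-dimensional, it is indexed by the support of `p`. -/
structure Frame (p : A.Point) (hc : A.IsCommutative) (hs : A.IsSeparable) where
  vec : p.support hc hs → A.carrier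
  mem_component : ∀ f : p.support hc hs, vec f ∈ p.component ((f : MulAction.stabilizer G p) : G)
  ne_zero : ∀ f, vec f ≠ 0
  vec_one : vec 1 = p

variable {hc : A.IsCommutative} {hs : A.IsSeparable}

instance : Nonempty (p.Frame hc hs) := by
  have h_vec (f : p.support hc hs) :
      ∃ x ∈ p.component ((f : MulAction.stabilizer G p) : G), x ≠ 0 ∧ (f = 1 → x = p) := by
    by_cases hf : f = 1
    · subst hf
      exact ⟨p, val_mem_component, p.ne_zero, fun _ ↦ rfl⟩
    · obtain ⟨x, hx, hx0⟩ := f.2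
      exact ⟨x, hx, hx0, fun h ↦ absurd h hf⟩
  choose vec h_mem h_ne h_one using h_vec
  exact ⟨⟨vec, h_mem, h_ne, h_one 1 rfl⟩⟩

namespace Frame

variable (e : p.Frame hc hs)

lemma mem_grade (f : p.support hc hs) :
    e.vec f ∈ A.grade ((f : MulAction.stabilizer G p) : G) :=
  (e.mem_component f).1

lemma val_mul_vec (f : p.support hc hs) : A.mul p (e.vec f) = e.vec f :=
  (e.mem_component f).2

lemma exists_units_smul_vec (f : p.support hc hs) {x : A.carrier}
    (hx : x ∈ p.component ((f : MulAction.stabilizer G p) : G)) (h0 : x ≠ 0) :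
    ∃ t : kˣ, x = (t : k) • e.vec f := by
  obtain ⟨t, rfl⟩ := exists_eq_smul hc hs (e.mem_component f) (e.ne_zero f) hx
  exact ⟨Units.mk0 t (left_ne_zero_of_smul h0), rfl⟩

lemma units_ext {f : p.support hc hs} {s t : kˣ} (h : (s : k) • e.vec f = (t : k) • e.vec f) :
    s = t :=
  Units.ext (smul_left_injective k (e.ne_zero f) h)

lemma exists_vec_mul_vec (f g : p.support hc hs) :
    ∃ t : kˣ, A.mul (e.vec f) (e.vec g) = (t : k) • e.vec (f * g) :=
  e.exists_units_smul_vec (f * g) (mul_mem_component (e.mem_component f) (e.mem_grade g))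
    (mul_ne_zero hc hs (e.mem_component f) (e.ne_zero f) (e.mem_component g) (e.ne_zero g))

lemma exists_act_vec (h : MulAction.stabilizer G p) (f : p.support hc hs) :
    ∃ t : kˣ, A.act h (e.vec f) = (t : k) • e.vec (MulAut.conjNormal h f) :=
  e.exists_units_smul_vec _ (by simpa using act_mem_component h.2 (e.mem_component f))
    (A.act_eq_zero_iff.not.2 (e.ne_zero f))

/-- The cochain `γ` of structure constants of the multiplication of `pA`. -/
noncomputable def mulCoeff (f g : p.support hc hs) : kˣ := (e.exists_vec_mul_vec f g).choose

/-- The structure constants `ε` of the action of the stabiliser of `p` on `pA`. -/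
noncomputable def actCoeff (h : MulAction.stabilizer G p) (f : p.support hc hs) : kˣ :=
  (e.exists_act_vec h f).choose

lemma vec_mul_vec (f g : p.support hc hs) :
    A.mul (e.vec f) (e.vec g) = (e.mulCoeff f g : k) • e.vec (f * g) :=
  (e.exists_vec_mul_vec f g).choose_spec

lemma act_vec (h : MulAction.stabilizer G p) (f : p.support hc hs) :
    A.act h (e.vec f) = (e.actCoeff h f : k) • e.vec (MulAut.conjNormal h f) :=
  (e.exists_act_vec h f).choose_spec

lemma mulCoeff_mul_mulCoeff (f g l : p.support hc hs) :
    e.mulCoeff g l * e.mulCoeff f (g * l) = α f g l * e.mulCoeff f g * e.mulCoeff (f * g) l := by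
  have h_assoc := A.mul_assoc _ _ _ _ (e.mem_grade f) _ (e.mem_grade g) _ (e.mem_grade l)
  simp only [vec_mul_vec, map_smul, LinearMap.smul_apply, smul_smul, ← Units.val_mul,
    ← _root_.mul_assoc] at h_assoc
  exact e.units_ext h_assoc

lemma actCoeff_mul (g h : MulAction.stabilizer G p) (f : p.support hc hs) :
    e.actCoeff (g * h) f =
      e.actCoeff g (MulAut.conjNormal h f) * e.actCoeff h f * α.proj g h f := by
  refine e.units_ext (f := MulAut.conjNormal (g * h) f) ?_
  rw [← act_vec]
  refine (A.act_act g h _ _ (e.mem_grade f)).trans ?_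
  simp only [act_vec, map_smul, smul_smul, map_mul, MulAut.mul_apply, Units.val_mul]
  congr 1
  ring

lemma mulCoeff_mul_actCoeff (h : MulAction.stabilizer G p) (f g : p.support hc hs) :
    e.mulCoeff f g * e.actCoeff h (f * g) = α.tens h f g * e.actCoeff h f * e.actCoeff h g *
      e.mulCoeff (MulAut.conjNormal h f) (MulAut.conjNormal h g) := by
  have h_act := A.act_mul h _ _ _ (e.mem_grade f) _ (e.mem_grade g)
  simp only [vec_mul_vec, act_vec, map_smul, LinearMap.smul_apply, smul_smul, ← map_mul,
    ← Units.val_mul] at h_act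
  rw [e.units_ext h_act]
  ac_rfl

lemma mulCoeff_eq_actCoeff_mul (f g : p.support hc hs) :
    e.mulCoeff f g =
      e.actCoeff f g * e.mulCoeff (MulAut.conjNormal (f : MulAction.stabilizer G p) g) f := by
  have h_comm := hc _ _ (e.mem_grade f) (e.vec g)
  have h_conj : MulAut.conjNormal (f : MulAction.stabilizer G p) g * f = f * g :=
    Subtype.ext (by simp)
  simp only [vec_mul_vec, act_vec, map_smul, LinearMap.smul_apply, smul_smul, ← Units.val_mul,
    h_conj] at h_comm
  exact e.units_ext h_comm

lemma isCompatible : IsCompatible (α.restrict (MulAction.stabilizer G p)) (p.support hc hs)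
    e.mulCoeff e.actCoeff where
  one_left f := by
    refine e.units_ext (f := 1 * f) ?_
    rw [← vec_mul_vec, e.vec_one, e.val_mul_vec, _root_.one_mul, Units.val_one, one_smul]
  one_right f := by
    refine e.units_ext (f := f * 1) ?_
    rw [← vec_mul_vec, e.vec_one, mul_val_of_mem_component hc (e.mem_component f), _root_.mul_one,
      Units.val_one, one_smul]
  coboundary f g l := by
    change _ = α f g l
    rw [mul_inv_eq_iff_eq_mul, mul_right_comm, mul_inv_eq_iff_eq_mul, mulCoeff_mul_mulCoeff]
  eps1 := e.actCoeff_mul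
  eps2 := e.mulCoeff_mul_actCoeff
  eps3 := e.mulCoeff_eq_actCoeff_mul

end Frame

end Point

section Transfer

variable {H : Subgroup G} {B : ZAlg.{u, v, w'} (α.restrict H)}

/-- A homomorphism of algebras in `Z(H, α|_H)` from the part of `A` of degrees in `H` to `B`, given
as a linear map on all of `A` that vanishes in the degrees outside `H`. -/
structure RestrictedHom (A : ZAlg.{u, v, w} α) (B : ZAlg.{u, v, w'} (α.restrict H)) where
  toLinearMap : A.carrier →ₗ[k] B.carrier
  map_mem : ∀ g, ∀ a ∈ A.grade g, toLinearMap a ∈ B.gradeExt g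
  map_act : ∀ (h : H) a, toLinearMap (A.act h a) = B.act h (toLinearMap a)
  map_mul : ∀ a b, toLinearMap (A.mul a b) = B.mul (toLinearMap a) (toLinearMap b)
  map_one : toLinearMap A.one = B.one

instance : CoeFun (RestrictedHom A B) fun _ ↦ A.carrier → B.carrier := ⟨fun φ ↦ φ.toLinearMap⟩

namespace RestrictedHom

variable (φ : RestrictedHom A B)

/-- The homomorphism `A → E(B)` that corresponds to `φ` by Frobenius reciprocity, with values in
the space of all maps `G → B`. -/
def mate : A.carrier →ₗ[k] (G → B.carrier) :=
  LinearMap.pi fun x ↦ φ.toLinearMap ∘ₗ A.act x⁻¹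

lemma mate_apply (a : A.carrier) (x : G) : φ.mate a x = φ (A.act x⁻¹ a) := rfl

lemma mate_mem_transferHomog {f : G} {a : A.carrier} (ha : a ∈ A.grade f) :
    φ.mate a ∈ transferHomog B.toZObj f := by
  refine ⟨fun x ↦ φ.map_mem _ _ (by simpa using A.act_mem x⁻¹ ha), fun x h ↦ ?_⟩
  rw [mate_apply, mul_inv_rev, A.act_act _ _ _ _ ha, map_smul, mate_apply, ← φ.map_act,
    Subgroup.coe_inv]

lemma mate_mem_transferSpace (a : A.carrier) : φ.mate a ∈ transferSpace B.toZObj :=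
  ZObj.map_mem_of_forall_mem_grade
    (fun f _ ha ↦ Submodule.mem_iSup_of_mem f (φ.mate_mem_transferHomog ha)) a

lemma mate_one : φ.mate A.one = fun _ ↦ B.one := by
  ext x
  rw [mate_apply, A.act_one, φ.map_one]

section

variable [Finite G]

lemma mate_act (g : G) (a : A.carrier) :
    φ.mate (A.act g a) = mapAct B.toZObj g (φ.mate a) := by
  have : φ.mate ∘ₗ A.act g = mapAct B.toZObj g ∘ₗ φ.mate := ZObj.hom_ext fun f a ha ↦ by
    ext x
    rw [LinearMap.comp_apply, LinearMap.comp_apply,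
      mapAct_of_mem (φ.mate_mem_transferHomog ha), mate_apply, mate_apply, mul_inv_rev, inv_inv,
      A.act_act _ _ _ _ ha, map_smul]
    exact (inv_smul_smul (α.proj x⁻¹ g f) _).symm
  exact LinearMap.congr_fun this a

lemma mate_mul (a b : A.carrier) :
    φ.mate (A.mul a b) = mapMul B (φ.mate a) (φ.mate b) := by
  have : A.mul.compr₂ φ.mate = (mapMul B).compl₁₂ φ.mate φ.mate :=
    ZObj.hom_ext₂ fun f g a ha b hb ↦ by
      ext x
      rw [LinearMap.compr₂_apply, LinearMap.compl₁₂_apply,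
        mapMul_of_mem (φ.mate_mem_transferHomog ha) (φ.mate_mem_transferHomog hb), mate_apply,
        A.act_mul _ _ _ _ ha _ hb, map_smul, φ.map_mul, mate_apply, mate_apply]
  exact LinearMap.congr_fun₂ this a b

end

end RestrictedHom

end Transfer

section Localization

variable {p : A.Point} {B : ZAlg.{u, v, w'} (α.restrict (MulAction.stabilizer G p))}

/-- `φ` identifies the ideal `pA` with `B`. -/
structure RestrictedHom.IsLocalizationAt (φ : RestrictedHom A B) : Prop where
  map_eq_zero_iff : ∀ a, φ a = 0 ↔ A.mul p a = 0
  exists_map_eq : ∀ g, ∀ b ∈ B.gradeExt g, ∃ a ∈ A.grade g, φ a = b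

namespace RestrictedHom.IsLocalizationAt

variable {φ : RestrictedHom A B} (hφ : φ.IsLocalizationAt)

include hφ

lemma map_val : φ p.val = B.one := by
  rw [← φ.map_one, eq_comm, ← sub_eq_zero, ← map_sub, hφ.map_eq_zero_iff, map_sub, A.mul_one,
    p.mul_self, sub_self]

open Classical in
lemma mate_mul_apply (hc : A.IsCommutative) (q : A.Point) (a : A.carrier) (y : G) :
    φ.mate (A.mul q a) y = if y • p = q then φ.mate a y else 0 := by
  rw [RestrictedHom.mate_apply, A.act_mul_of_left_mem_one q.mem_one, φ.map_mul, ← Point.val_smul]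
  split_ifs with h
  · rw [← h, inv_smul_smul, hφ.map_val, B.one_mul, RestrictedHom.mate_apply]
  · have h_ne : p ≠ y⁻¹ • q := fun h_eq ↦ h (by rw [h_eq, smul_inv_smul])
    rw [(hφ.map_eq_zero_iff _).2 (Point.mul_eq_zero hc h_ne), LinearMap.map_zero₂]

lemma mate_injective (hi : A.IsIndecomposable) (hc : A.IsCommutative)
    [Finite G] : Function.Injective φ.mate := by
  have : Fintype (MulAction.orbit G p) := @Fintype.ofFinite _ (Set.finite_range _)
  refine (injective_iff_map_eq_zero _).2 fun a ha ↦ ?_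
  have h_mul (q : MulAction.orbit G p) : A.mul q.1 a = 0 := by
    obtain ⟨_, x, rfl⟩ := q
    have h_zero : φ (A.act x⁻¹ a) = 0 := congrFun ha x
    rwa [hφ.map_eq_zero_iff, ← p.act_inv_mul_smul, A.act_eq_zero_iff] at h_zero
  rw [← A.one_mul a, ← p.sum_orbit hi hc, LinearMap.map_sum₂]
  exact Finset.sum_eq_zero fun q _ ↦ h_mul q

lemma exists_mate_apply_eq {f : G} {b : G → B.carrier} (hb : b ∈ transferHomog B.toZObj f)
    (x : G) : ∃ a, ∀ y, y • p = x • p → φ.mate a y = b y := by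
  obtain ⟨c, hc, hcb⟩ := hφ.exists_map_eq _ _ (hb.1 x)
  obtain ⟨a, ha, rfl⟩ : c ∈ (A.grade f).map (A.act x⁻¹) := by rwa [A.map_act, inv_inv]
  refine ⟨a, fun y hy ↦ ?_⟩
  let h : MulAction.stabilizer G p := ⟨x⁻¹ * y, by
    rw [MulAction.mem_stabilizer_iff, mul_smul, hy, inv_smul_smul]⟩
  have hxh : y = x * h := (mul_inv_cancel_left x y).symm
  rw [hxh, (φ.mate_mem_transferHomog ha).2, hb.2, φ.mate_apply, hcb]

lemma transferHomog_le_range_mate (hc : A.IsCommutative) [Finite G] (f : G) :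
    transferHomog B.toZObj f ≤ LinearMap.range φ.mate := by
  classical
  have : Fintype (MulAction.orbit G p) := @Fintype.ofFinite _ (Set.finite_range _)
  intro b hb
  have h_local (q : MulAction.orbit G p) : ∃ a, ∀ y, y • p = q → φ.mate a y = b y := by
    obtain ⟨_, x, rfl⟩ := q
    exact hφ.exists_mate_apply_eq hb x
  choose a ha using h_local
  refine ⟨∑ q, A.mul q.1 (a q), funext fun y ↦ ?_⟩
  rw [map_sum, Finset.sum_apply,
    Finset.sum_eq_single ⟨y • p, MulAction.mem_orbit p y⟩ _ (by simp), hφ.mate_mul_apply hc,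
    if_pos rfl, ha _ y rfl]
  exact fun q _ hq ↦ by
    rw [hφ.mate_mul_apply hc, if_neg fun h ↦ hq (Subtype.ext h.symm)]

lemma range_mate (hc : A.IsCommutative) [Finite G] :
    LinearMap.range φ.mate = transferSpace B.toZObj :=
  le_antisymm (by rintro _ ⟨a, rfl⟩; exact φ.mate_mem_transferSpace a)
    (iSup_le (hφ.transferHomog_le_range_mate hc))

/-- An indecomposable commutative algebra is the transfer of its localisation at a point. -/
noncomputable def iso [Finite G] (hi : A.IsIndecomposable) (hc : A.IsCommutative) :
    A.Iso (transfer B) where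
  toEquiv := LinearEquiv.ofInjective φ.mate (hφ.mate_injective hi hc) ≪≫ₗ
    LinearEquiv.ofEq _ _ (hφ.range_mate hc)
  map_grade _ _ ha := φ.mate_mem_transferHomog ha
  map_act g a := Subtype.ext (φ.mate_act g a)
  map_mul a b := Subtype.ext (φ.mate_mul a b)
  map_one := Subtype.ext φ.mate_one

end RestrictedHom.IsLocalizationAt

end Localization

namespace Point.Frame

variable {p : A.Point} {hc : A.IsCommutative} {hs : A.IsSeparable} (e : p.Frame hc hs)

lemma exists_vec_eq_of_mem_component {g : G} {x : A.carrier} (hx : x ∈ p.component g)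
    (h0 : x ≠ 0) : ∃ (f : p.support hc hs) (t : kˣ),
      ((f : MulAction.stabilizer G p) : G) = g ∧ x = (t : k) • e.vec f := by
  let f : p.support hc hs := ⟨⟨g, mem_stabilizer_of_mem_component hc hx h0⟩, x, hx, h0⟩
  obtain ⟨t, ht⟩ := e.exists_units_smul_vec f hx h0
  exact ⟨f, t, rfl, ht⟩

lemma linearIndependent : LinearIndependent k e.vec :=
  (A.indep.comp (Subtype.val_injective.comp Subtype.val_injective)).linearIndependent _
    e.mem_grade e.ne_zero

lemma val_mul_mem_span (a : A.carrier) : A.mul p a ∈ Submodule.span k (Set.range e.vec) := by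
  refine ZObj.map_mem_of_forall_mem_grade (fun g a ha ↦ ?_) a
  by_cases h0 : A.mul p a = 0
  · rw [h0]
    exact zero_mem _
  · obtain ⟨f, t, -, hf⟩ := e.exists_vec_eq_of_mem_component (mul_mem_component_of_mem_grade ha) h0
    rw [hf]
    exact Submodule.smul_mem _ _ (Submodule.subset_span ⟨f, rfl⟩)

lemma val_mul_linearCombination (x : p.support hc hs →₀ k) :
    A.mul p (Finsupp.linearCombination k e.vec x) = Finsupp.linearCombination k e.vec x := by
  simp only [Finsupp.linearCombination_apply, map_finsuppSum, map_smul, val_mul_vec]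

/-- The coordinates of `p a` in the basis `e` of the ideal `pA`. -/
noncomputable def coord : A.carrier →ₗ[k] (p.support hc hs →₀ k) :=
  e.linearIndependent.repr ∘ₗ (A.mul p).codRestrict _ e.val_mul_mem_span

lemma linearCombination_coord (a : A.carrier) :
    Finsupp.linearCombination k e.vec (e.coord a) = A.mul p a :=
  e.linearIndependent.linearCombination_repr _

lemma coord_eq_iff {a : A.carrier} {x : p.support hc hs →₀ k} :
    e.coord a = x ↔ A.mul p a = Finsupp.linearCombination k e.vec x := by
  rw [← e.linearCombination_coord]
  exact e.linearIndependent.finsuppLinearCombination_injective.eq_iff.symm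

lemma coord_eq_zero_iff {a : A.carrier} : e.coord a = 0 ↔ A.mul p a = 0 := by
  rw [e.coord_eq_iff, map_zero]

lemma linearCombination_mem_grade {h : MulAction.stabilizer G p} {x : p.support hc hs →₀ k}
    (hx : x ∈ groupAlgGrade k (p.support hc hs) h) :
    Finsupp.linearCombination k e.vec x ∈ A.grade h := by
  obtain rfl | ⟨f, c, rfl, rfl⟩ := mem_groupAlgGrade hx
  · rw [map_zero]
    exact zero_mem _
  · rw [Finsupp.linearCombination_single]
    exact Submodule.smul_mem _ _ (e.mem_grade f)

lemma linearCombination_groupAlgMul (x y : p.support hc hs →₀ k) :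
    Finsupp.linearCombination k e.vec (groupAlgMul e.mulCoeff x y) =
      A.mul (Finsupp.linearCombination k e.vec x) (Finsupp.linearCombination k e.vec y) := by
  have : (groupAlgMul e.mulCoeff).compr₂ (Finsupp.linearCombination k e.vec) =
      A.mul.compl₁₂ (Finsupp.linearCombination k e.vec) (Finsupp.linearCombination k e.vec) := by
    ext f g
    simp [groupAlgMul_single, vec_mul_vec]
  exact LinearMap.congr_fun₂ this x y

lemma linearCombination_groupAlgAct (h : MulAction.stabilizer G p) (x : p.support hc hs →₀ k) :
    Finsupp.linearCombination k e.vec (groupAlgAct e.actCoeff h x) =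
      A.act h (Finsupp.linearCombination k e.vec x) := by
  have : Finsupp.linearCombination k e.vec ∘ₗ groupAlgAct e.actCoeff h =
      A.act h ∘ₗ Finsupp.linearCombination k e.vec := by
    ext f
    simp [groupAlgAct_single, act_vec]
  exact LinearMap.congr_fun this x

variable [Finite G]

lemma coord_mem_gradeExt {g : G} {a : A.carrier} (ha : a ∈ A.grade g) :
    e.coord a ∈ (twistedGroupAlg e.isCompatible).gradeExt g := by
  by_cases h0 : A.mul p a = 0
  · rw [e.coord_eq_zero_iff.2 h0]
    exact zero_mem _
  · obtain ⟨f, t, hf, hft⟩ :=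
      e.exists_vec_eq_of_mem_component (mul_mem_component_of_mem_grade ha) h0
    rw [e.coord_eq_iff.2 (hft.trans (Finsupp.linearCombination_single k (t : k) f).symm)]
    exact ZObj.mem_gradeExt_of_mem (X := (twistedGroupAlg e.isCompatible).toZObj)
      (single_mem_groupAlgGrade f (t : k) rfl) hf

/-- The coordinates of `p a` as a homomorphism to the twisted group algebra. -/
noncomputable def coordHom : RestrictedHom A (twistedGroupAlg e.isCompatible) where
  toLinearMap := e.coord
  map_mem _ _ ha := e.coord_mem_gradeExt ha
  map_act h a := e.coord_eq_iff.2 <| by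
    refine Eq.trans ?_ (e.linearCombination_groupAlgAct h (e.coord a)).symm
    rw [e.linearCombination_coord, p.mul_act h.2]
  map_mul a b := e.coord_eq_iff.2 <| by
    refine Eq.trans ?_ (e.linearCombination_groupAlgMul (e.coord a) (e.coord b)).symm
    rw [e.linearCombination_coord, e.linearCombination_coord,
      A.mul_assoc_of_mid_mem_one p.mem_one, ← hc.mul_comm_of_mem_one p.mem_one, p.mul_mul,
      A.mul_assoc_of_left_mem_one p.mem_one]
  map_one := e.coord_eq_iff.2 <| by
    refine Eq.trans ?_ (Finsupp.linearCombination_single k 1 1).symm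
    rw [one_smul, e.vec_one, A.mul_one]

lemma coordHom_isLocalizationAt : e.coordHom.IsLocalizationAt where
  map_eq_zero_iff _ := e.coord_eq_zero_iff
  exists_map_eq g b hb := by
    obtain rfl | ⟨_, hb⟩ := ZObj.mem_gradeExt hb
    · exact ⟨0, zero_mem _, map_zero _⟩
    · exact ⟨_, e.linearCombination_mem_grade hb, e.coord_eq_iff.2 (e.val_mul_linearCombination b)⟩

end Point.Frame

end ZAlg

end TwistedCentre

theorem mainTheorem2_general {k : Type u} [Field k] [IsAlgClosed k] {G : Type v} [Group G]
    [Finite G] (α : TwistedCentre.Cocycle3 G k) (A : TwistedCentre.ZAlg.{u, v, w} α)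
    (hA : A.IsEtale) :
    ∃ (H : Subgroup G) (F : Subgroup H) (_ : F.Normal) (γ : F → F → kˣ) (ε : H → F → kˣ)
      (h : TwistedCentre.IsCompatible (α.restrict H) F γ ε),
      Nonempty (A.Iso (TwistedCentre.etaleAlg α H F γ ε h)) := by
  have : Nontrivial A.carrier := hA.indecomposable.1
  obtain ⟨p⟩ := hA.separable.nonempty_point hA.commutative
  obtain ⟨e⟩ : Nonempty (p.Frame hA.commutative hA.separable) := inferInstance
  exact ⟨MulAction.stabilizer G p, p.support hA.commutative hA.separable, inferInstance,
    e.mulCoeff, e.actCoeff, e.isCompatible,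
    ⟨e.coordHom_isLocalizationAt.iso hA.indecomposable hA.commutative⟩⟩

theorem mainTheorem2 {k : Type u} [Field k] [IsAlgClosed k] [CharZero k]
    {G : Type v} [Group G] [Finite G] (α : TwistedCentre.Cocycle3 G k)
    (A : TwistedCentre.ZAlg.{u, v, w} α) (hA : A.IsEtale) :
    ∃ (H : Subgroup G) (F : Subgroup H) (_ : F.Normal) (γ : F → F → kˣ) (ε : H → F → kˣ)
      (h : TwistedCentre.IsCompatible (α.restrict H) F γ ε),
      Nonempty (A.Iso (TwistedCentre.etaleAlg α H F γ ε h)) := by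
  exact mainTheorem2_general α A hA
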